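/- Let $\nu$ be a (positive Borel) measure on $\mathbb{R}^N$, let $B_\delta=\{|z|<\delta\}$, $B=B_1$, and let $j:\mathbb{R}^N\times\mathbb{R}^N\to\mathbb{R}^N$ and $H:\mathbb{R}^N\times\mathbb{R}^N\to\mathbb{R}$ be such that $j(\cdot,z)$ and $H(\cdot,p)$ are $\mathbb{Z}^N$-periodic for all $z,p$. Assume: * (M) $\int_{\mathbb{R}^N}\min\{1,|z|^2\}\,\nu(dz)<\infty$. * (J1) There is $C_j>0$ with $|j(x,z)|\le C_j|z|$ for all $x,z$. Moreover $x\mapsto j(x,z)$ is continuous for each $z$, and $z\mapsto j(x,z)$ is continuous on $\mathrm{supp}\,\nu$ for each $x$. * (J2) For every $\delta>0$ there is $C_\delta>0$ such that for all $x,y$: $\int_{B_\delta}|j(x,z)-j(y,z)|^2\nu(dz)\le C_\delta|x-y|^2$ and $\int_{B\setminus B_\delta}|j(x,z)-j(y,z)|\nu(dz)\le C_\delta|x-y|$. * (Iterative covering) With $X_0(x)=\{x\}$ and $X_{n+1}(x)=\bigcup_{\xi\in X_n(x)}\{\xi+j(\xi,z):z\in\mathrm{supp}\,\nu\}$, for every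 $x$ the image of $\bigcup_{n\ge 0}X_n(x)$ in $\mathbb{T}^N=\mathbb{R}^N/\mathbb{Z}^N$ is dense in $\mathbb{T}^N$. * (H0) $H(\cdot,0)$ is bounded. * (H1) There are $m>1$, a modulus of continuity $\zeta_1$ and $c>0$ such that, with $\zeta_2(s)=c|s|$, for all $x,y,p,q\in\mathbb{R}^N$ with $|q|\le 1$, $$H(y,p+q)-H(x,p)\le\zeta_1(|x-y|)(1+|p|^m)+\zeta_2(|q|)(1+|p|^{m-1}).$$ * (H2) With the same $m$, there are $A,b_0>0$ such that for all $\mu\in(0,1)$ and all $x,p$: $H(x,p)-\mu H(x,\mu^{-1}p)\le(1-\mu)\big(b_0(1-m)|p|^m+A\big)$. For $S\subseteq\mathbb{R}^N$ put $I_x^j[S](w,x,p)=\int_S\big[w(x+j(x,z))-w(x)-\mathbf 1_B(z)\langle p,j(x,z)\rangle\big]\nu(dz)$, and consider $$\partial_t u-I_x^j(u(\cdot,t),x)+H(x,Du)=0\quad\text{in }\mathbb{T}^N\times(0,\infty),\qquad(*)$$ where $I^j_x(w,x)=I^j_x[\mathbb{R}^N](w,x,Dw(x))$. A function $u$, upper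 semicontinuous on $\mathbb{T}^N\times[0,\infty)$, is a viscosity subsolution of $(*)$ if, whenever $\varphi$ is $C^2$, $x\in\mathbb{R}^N$, $t,r,\delta>0$, $|j(x,z)|<r$ for all $|z|<\delta$, and $u-\varphi$ attains at $(x,t)$ its maximum over $\{(y,s):|y-x|<r,\ |s-t|<r,\ s>0\}$, one has, with $p=D\varphi(x,t)$, $$\partial_t\varphi(x,t)-I_x^j[B_\delta](\varphi(\cdot,t),x,p)-I_x^j[B_\delta^c](u(\cdot,t),x,p)+H(x,p)\le 0.$$ Viscosity supersolutions are lower semicontinuous on $\mathbb{T}^N\times[0,\infty)$ and are defined with minimum and $\ge$. Let $u$ and $v$ be a $\mathbb{Z}^N$-periodic viscosity subsolution and supersolution of $(*)$, both bounded on $\mathbb{T}^N\times[0,T]$ for every $T>0$, and let $(x_0,t_0)\in\mathbb{T}^N\times(0,\infty)$ satisfy $$(u-v)(x_0,t_0)=\sup_{\mathbb{T}^N\times(0,\infty)}(u-v).$$ Then $u-v$ is constant, equal to $(u-v)(x_0,t_0)$, on $\mathbb{T}^N\times(0,t_0]$. If, moreover, $(u-v)(x,0)\le(u-v)(x_0,t_0)$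 for all $x$ (that is, $(u-v)(x_0,t_0)$ is the supremum over $\mathbb{T}^N\times[0,\infty)$, as is automatic when $u$ and $v$ are continuous up to $t=0$), then $u-v$ is constant on $\mathbb{T}^N\times[0,t_0]$ and $$(u-v)(x,t)=\sup_{y\in\mathbb{T}^N}\{u(y,0)-v(y,0)\}\qquad\text{for all }(x,t)\in\mathbb{T}^N\times[0,t_0].$$ -/

import Mathlib

open Set Filter Topology MeasureTheory

noncomputable section

namespace LevyIto

/-- Euclidean space `ℝ^N`. -/
abbrev RN (N : ℕ) := EuclideanSpace ℝ (Fin N)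

/-- The integer vector `k`, viewed in `ℝ^N`. -/
def latticeVec {N : ℕ} (k : Fin N → ℤ) : RN N := WithLp.toLp 2 (fun i => (k i : ℝ))

/-- `ℤ^N`-periodicity; such functions are the lifts to `ℝ^N` of functions on the torus. -/
def IntPeriodic {N : ℕ} {β : Type*} (f : RN N → β) : Prop :=
  ∀ (k : Fin N → ℤ) (x : RN N), f (x + latticeVec k) = f x

/-- The projection of `ℝ^N` onto the torus `𝕋^N = (ℝ/ℤ)^N`. -/
def toTorus {N : ℕ} (x : RN N) : UnitAddTorus (Fin N) := fun i => ((x i : ℝ) : UnitAddCircle)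

/-- (M): `∫ min {1, |z|²} ν(dz) < ∞`. -/
def LevyCondition {N : ℕ} (ν : Measure (RN N)) : Prop :=
  Integrable (fun z : RN N => min 1 (‖z‖ ^ 2)) ν

/-- (J1): `|j(x,z)| ≤ C |z|` uniformly in `x`. -/
def JumpBound {N : ℕ} (j : RN N → RN N → RN N) : Prop :=
  ∃ C : ℝ, 0 < C ∧ ∀ x z, ‖j x z‖ ≤ C * ‖z‖

/-- (J2): integrated Lipschitz dependence of the jumps on the base point. -/
def JumpLipschitz {N : ℕ} (ν : Measure (RN N)) (j : RN N → RN N → RN N) : Prop :=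
  ∀ δ : ℝ, 0 < δ → ∃ C : ℝ, 0 < C ∧ ∀ x y : RN N,
    (∫⁻ z in Metric.ball 0 δ, ENNReal.ofReal (‖j x z - j y z‖ ^ 2) ∂ν
        ≤ ENNReal.ofReal (C * ‖x - y‖ ^ 2)) ∧
    (∫⁻ z in Metric.ball 0 1 \ Metric.ball 0 δ, ENNReal.ofReal ‖j x z - j y z‖ ∂ν
        ≤ ENNReal.ofReal (C * ‖x - y‖))

/-- A modulus of continuity on `[0,∞)`. -/
structure IsModulus (ζ : ℝ → ℝ) : Prop where
  zero : ζ 0 = 0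
  mono : MonotoneOn ζ (Ici 0)
  cont : ContinuousWithinAt ζ (Ici 0) 0

/-- (H0): `H(·,0)` is bounded. -/
def HamiltonianH0 {N : ℕ} (H : RN N → RN N → ℝ) : Prop :=
  ∃ H₀ : ℝ, 0 < H₀ ∧ ∀ x, |H x 0| ≤ H₀

/-- (H1), for increments `q` with `|q| ≤ 1`. -/
def HamiltonianH1 {N : ℕ} (H : RN N → RN N → ℝ) (m : ℝ) (ζ₁ ζ₂ : ℝ → ℝ) : Prop :=
  ∀ x y p q : RN N, ‖q‖ ≤ 1 →
    H y (p + q) - H x p ≤ ζ₁ ‖x - y‖ * (1 + ‖p‖ ^ m) + ζ₂ ‖q‖ * (1 + ‖p‖ ^ (m - 1))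

/-- (H2): superlinear coercivity of order `m`. -/
def HamiltonianH2 {N : ℕ} (H : RN N → RN N → ℝ) (m : ℝ) : Prop :=
  ∃ A b₀ : ℝ, 0 < A ∧ 0 < b₀ ∧ ∀ μ : ℝ, μ ∈ Ioo (0 : ℝ) 1 → ∀ x p : RN N,
    H x p - μ * H x (μ⁻¹ • p) ≤ (1 - μ) * (b₀ * (1 - m) * ‖p‖ ^ m + A)

/-- `I_x^j[S](w, x, p) = ∫_S [w(x + j(x,z)) - w(x) - 1_B(z) ⟨p, j(x,z)⟩] ν(dz)`,
`B` the open unit ball. -/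
def nonlocalOp {N : ℕ} (ν : Measure (RN N)) (j : RN N → RN N → RN N)
    (S : Set (RN N)) (w : RN N → ℝ) (x p : RN N) : ℝ :=
  ∫ z in S, (w (x + j x z) - w x
    - (Metric.ball (0 : RN N) 1).indicator (fun z => inner ℝ p (j x z)) z) ∂ν

/-- The left-hand side of the viscosity inequality at `(x,t)`: the function `w` itself is used
for the jumps with `|z| ≥ δ` and the test function `φ` everywhere else,
`∂_t φ - I[B_δ](φ(·,t), x, Dφ) - I[B_δᶜ](w(·,t), x, Dφ) + H(x, Dφ)`. -/
def viscosityLHS {N : ℕ} (ν : Measure (RN N)) (j : RN N → RN N → RN N)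
    (H : RN N → RN N → ℝ) (δ : ℝ) (w φ : RN N → ℝ → ℝ) (x : RN N) (t : ℝ) : ℝ :=
  let p : RN N := gradient (fun y => φ y t) x
  deriv (fun s => φ x s) t
    - nonlocalOp ν j (Metric.ball 0 δ) (fun y => φ y t) x p
    - nonlocalOp ν j (Metric.ball 0 δ)ᶜ (fun y => w y t) x p
    + H x p

/-- `u` is a viscosity subsolution of `∂_t u - I_x^j(u(·,t),x) + H(x,Du) = 0` in
`ℝ^N × (0,∞)`, upper semicontinuous on `ℝ^N × [0,∞)`. The values `u x t` with `t < 0` play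
no role. The maximum is taken over a cylinder which contains all jumps with `|z| < δ`. -/
structure IsViscositySubsolution {N : ℕ} (ν : Measure (RN N)) (j : RN N → RN N → RN N)
    (H : RN N → RN N → ℝ) (u : RN N → ℝ → ℝ) : Prop where
  usc : UpperSemicontinuousOn (fun q : RN N × ℝ => u q.1 q.2) (univ ×ˢ Ici 0)
  ineq : ∀ (φ : RN N → ℝ → ℝ), ContDiff ℝ 2 (fun q : RN N × ℝ => φ q.1 q.2) →
    ∀ (x : RN N) (t r δ : ℝ), 0 < t → 0 < r → 0 < δ →
    (∀ z : RN N, ‖z‖ < δ → ‖j x z‖ < r) →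
    (∀ (y : RN N) (s : ℝ), ‖y - x‖ < r → |s - t| < r → 0 < s →
      u y s - φ y s ≤ u x t - φ x t) →
    viscosityLHS ν j H δ u φ x t ≤ 0

/-- `v` is a viscosity supersolution of the same equation in `ℝ^N × (0,∞)`, lower
semicontinuous on `ℝ^N × [0,∞)`. -/
structure IsViscositySupersolution {N : ℕ} (ν : Measure (RN N)) (j : RN N → RN N → RN N)
    (H : RN N → RN N → ℝ) (v : RN N → ℝ → ℝ) : Prop where
  lsc : LowerSemicontinuousOn (fun q : RN N × ℝ => v q.1 q.2) (univ ×ˢ Ici 0)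
  ineq : ∀ (φ : RN N → ℝ → ℝ), ContDiff ℝ 2 (fun q : RN N × ℝ => φ q.1 q.2) →
    ∀ (x : RN N) (t r δ : ℝ), 0 < t → 0 < r → 0 < δ →
    (∀ z : RN N, ‖z‖ < δ → ‖j x z‖ < r) →
    (∀ (y : RN N) (s : ℝ), ‖y - x‖ < r → |s - t| < r → 0 < s →
      v x t - φ x t ≤ v y s - φ y s) →
    0 ≤ viscosityLHS ν j H δ v φ x t

/-- Bounded on `ℝ^N × [0,T]` for every `T > 0`. -/
def BoundedOnStrips {N : ℕ} (w : RN N → ℝ → ℝ) : Prop :=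
  ∀ T : ℝ, 0 < T → ∃ R : ℝ, ∀ (x : RN N) (t : ℝ), t ∈ Icc 0 T → |w x t| ≤ R

/-- The points reachable from `x` in `n` jumps:
`X_0(x) = {x}`, `X_{n+1}(x) = ⋃_{ξ ∈ X_n(x)} (ξ + j(ξ, supp ν))`. -/
def reach {N : ℕ} (ν : Measure (RN N)) (j : RN N → RN N → RN N) (x : RN N) : ℕ → Set (RN N)
  | 0 => {x}
  | n + 1 => ⋃ ξ ∈ reach ν j x n, (fun z => ξ + j ξ z) '' ν.support

/-- The iterative covering property: for every `x`, the closure in the torus of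
`⋃_n X_n(x)` is the whole torus. -/
def IterativeCovering {N : ℕ} (ν : Measure (RN N)) (j : RN N → RN N → RN N) : Prop :=
  ∀ x : RN N, closure (toTorus '' ⋃ n, reach ν j x n) = univ

end LevyIto

end

noncomputable section

namespace LevyIto

/-! The Hamiltonian is superlinear in the gradient, so subtracting the two viscosity inequalities
leaves a difference of Hamiltonians that (H1) alone cannot control at large gradients. The remedy is
to compare `μ * u - v` with μ < 1. By (H2), passing from u to μu creates a coercive term (1 - μ) b₀
(m - 1) |p|^m of good sign. It absorbs the (H1) errors ζ₁(|x - y|) |p|^m and |q| |p|^(m-1) as soon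
as ζ₁ and |q| are suitably small multiples of 1 - μ, respectively bounded by a multiple of 1 - μ;
what remains is O(1 - μ) (`hamiltonian_difference_lower`).

Accordingly a maximum point (xb, tb) of u - v - θt over a time interval [a, b] is localized by the
penalty K(1 - μ)(|x - xb|² + (t - tb)²), of the same order as the linearization error, and the
variables are doubled with a weight l. For fixed μ, l|x - y|² can be made negligible, and (J2)
bounds the mismatch of the jumps from x and from y by multiples of it. Jumps smaller than δ₀ are
handled by maximality; larger ones are kept. Letting μ → 1, `exists_contact_point` yields a maximum
point (x, t) of u - v - θt, within O(K^(-1/2)) of (xb, tb), such that θ ≤ ∫_{|z| ≥ δ₀} [(u - v)(x +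
j(x,z), t) - (u - v)(x, t)] ν(dz).

The integrand is nonpositive by maximality, and this is used twice. If θ > 0 the inequality is
absurd; a deficit of u - v at some time a < t₀ would produce such a tilted maximum away from the
ends, so the maximum is attained at every earlier time (`exists_max_at_earlier_time`). If θ = 0 the
integrand vanishes, so jumps from (x, t) land on the maximum again, and K → ∞ carries this over to
(xb, tb) (`max_at_jump`).

At each time in (0, t₀] the contact set is therefore nonempty, closed, periodic and stable under
jumps; iterative covering makes it everything. Time 0 follows by semicontinuity. -/

/-- The structural assumptions on the pair `(ν, j)`, with an explicit growth constant `C`. -/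
structure JumpKernel {N : ℕ} (ν : Measure (RN N)) (j : RN N → RN N → RN N) (C : ℝ) : Prop where
  levy : LevyCondition ν
  pos : 0 < C
  bound : ∀ x z, ‖j x z‖ ≤ C * ‖z‖
  cont_left : ∀ z, Continuous (fun x => j x z)
  cont_right : ∀ x, ContinuousOn (j x) ν.support
  lip : JumpLipschitz ν j

/-! ### Integrability and Lipschitz estimates for the jumps -/

section Kernel

variable {N : ℕ} {ν : Measure (RN N)} {j : RN N → RN N → RN N} {C : ℝ}

lemma JumpKernel.measure_compl_ball (hj : JumpKernel ν j C) {δ : ℝ} (hδ : 0 < δ) :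
    ν (Metric.ball 0 δ)ᶜ < ⊤ := by
  have h1 : 0 < min 1 (δ ^ 2) := by positivity
  refine lt_of_le_of_lt (measure_mono ?_) (hj.levy.measure_norm_ge_lt_top h1)
  intro z hz
  have hz : δ ≤ ‖z‖ := by simpa using hz
  have : min 1 (δ ^ 2) ≤ min 1 (‖z‖ ^ 2) := min_le_min le_rfl (by gcongr)
  exact this.trans (le_abs_self _)

lemma JumpKernel.isFiniteMeasure_restrict (hj : JumpKernel ν j C) {δ : ℝ} (hδ : 0 < δ)
    {S : Set (RN N)} (hS : S ⊆ (Metric.ball 0 δ)ᶜ) : IsFiniteMeasure (ν.restrict S) :=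
  ⟨by simpa using (measure_mono hS).trans_lt (hj.measure_compl_ball hδ)⟩

lemma JumpKernel.integrableOn_normSq (hj : JumpKernel ν j C) :
    IntegrableOn (fun z : RN N => ‖z‖ ^ 2) (Metric.ball 0 1) ν := by
  refine (hj.levy.integrableOn (s := Metric.ball 0 1)).congr ?_
  filter_upwards [ae_restrict_mem measurableSet_ball] with z hz
  have hz : ‖z‖ < 1 := by simpa using hz
  exact min_eq_right (by nlinarith [norm_nonneg z])

/-- Continuity in z is available only on the support, which carries all of ν. -/
lemma JumpKernel.aestronglyMeasurable (hj : JumpKernel ν j C) (x : RN N) (S : Set (RN N)) :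
    AEStronglyMeasurable (j x) (ν.restrict S) := by
  have h := (hj.cont_right x).aestronglyMeasurable (μ := ν) Measure.isClosed_support.measurableSet
  have e : ν.restrict ν.support = ν := Measure.restrict_eq_self_of_ae_mem Measure.support_mem_ae
  rw [e] at h
  exact h.restrict

lemma JumpKernel.apply_zero (hj : JumpKernel ν j C) (x : RN N) : j x 0 = 0 := by
  simpa using hj.bound x 0

/-- Serves to make the test-function parts of the viscosity inequalities, which are multiples of
∫_{B_δ} |j|², negligible once α and l are fixed. -/
lemma JumpKernel.exists_small_ball (hj : JumpKernel ν j C) {e : ℝ} (he : 0 < e) (r : ℝ)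
    (hr : 0 < r) :
    ∃ δ : ℝ, 0 < δ ∧ δ < r ∧ ∫ z in Metric.ball (0 : RN N) δ, ‖z‖ ^ 2 ∂ν < e := by
  have hint := (integrable_indicator_iff measurableSet_ball).2 hj.integrableOn_normSq
  have key : Tendsto (fun δ : ℝ => ∫ z, (Metric.ball (0 : RN N) δ).indicator
      ((Metric.ball (0 : RN N) 1).indicator (fun z => ‖z‖ ^ 2)) z ∂ν) (𝓝[>] 0) (𝓝 (∫ _, 0 ∂ν)) := by
    refine tendsto_integral_filter_of_dominated_convergence
      ((Metric.ball (0 : RN N) 1).indicator (fun z => ‖z‖ ^ 2)) ?_ ?_ hint ?_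
    · exact Eventually.of_forall fun δ => (hint.indicator measurableSet_ball).aestronglyMeasurable
    · refine Eventually.of_forall fun δ => Eventually.of_forall fun z => ?_
      refine (norm_indicator_le_norm_self _ _).trans (le_of_eq ?_)
      refine Real.norm_of_nonneg (indicator_nonneg (fun _ _ => by positivity) _)
    · refine Eventually.of_forall fun z => ?_
      -- An atom of ν at the origin is harmless, because |z|² vanishes there.
      rcases eq_or_ne z 0 with rfl | hz
      · refine tendsto_const_nhds.congr fun δ => ?_
        by_cases h : (0 : RN N) ∈ Metric.ball (0 : RN N) δ <;> simp [h]
      · refine tendsto_const_nhds.congr' ?_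
        have : Ioo (0 : ℝ) ‖z‖ ∈ 𝓝[>] (0 : ℝ) := Ioo_mem_nhdsGT (norm_pos_iff.2 hz)
        filter_upwards [this] with δ hδ
        rw [indicator_of_notMem]
        simpa using hδ.2.le
  simp only [integral_zero] at key
  have h1 : Ioo (0 : ℝ) (min r 1) ∈ 𝓝[>] (0 : ℝ) := Ioo_mem_nhdsGT (by positivity)
  obtain ⟨δ, hδ, hδ'⟩ := ((key.eventually (gt_mem_nhds he)).and h1).exists
  refine ⟨δ, hδ'.1, hδ'.2.trans_le (min_le_left _ _), ?_⟩
  rwa [integral_indicator measurableSet_ball, setIntegral_congr_fun measurableSet_ball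
    (g := fun z => ‖z‖ ^ 2)] at hδ
  intro z hz
  have : z ∈ Metric.ball (0 : RN N) 1 :=
    Metric.ball_subset_ball (hδ'.2.le.trans (min_le_right _ _)) hz
  simp only [indicator_of_mem this]

lemma JumpKernel.integrableOn_jumpSq (hj : JumpKernel ν j C) (x : RN N) {S : Set (RN N)}
    (hS : S ⊆ Metric.ball 0 1) : IntegrableOn (fun z => ‖j x z‖ ^ 2) S ν := by
  refine ((hj.integrableOn_normSq.mono_set hS).const_mul (C ^ 2)).mono'
    ((hj.aestronglyMeasurable x S).norm.pow 2) (Eventually.of_forall fun z => ?_)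
  rw [Real.norm_of_nonneg (by positivity), ← mul_pow]
  exact pow_le_pow_left₀ (norm_nonneg _) (hj.bound x z) 2

lemma JumpKernel.integral_jumpSq_le (hj : JumpKernel ν j C) (x : RN N) {S : Set (RN N)}
    (hS : S ⊆ Metric.ball 0 1) :
    ∫ z in S, ‖j x z‖ ^ 2 ∂ν ≤ C ^ 2 * ∫ z in S, ‖z‖ ^ 2 ∂ν := by
  rw [← integral_const_mul]
  refine integral_mono (hj.integrableOn_jumpSq x hS)
    ((hj.integrableOn_normSq.mono_set hS).const_mul (C ^ 2)) fun z => ?_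
  simp only [← mul_pow]
  exact pow_le_pow_left₀ (norm_nonneg _) (hj.bound x z) 2

lemma integrable_and_integral_le_of_lintegral_le {X : Type*} [MeasurableSpace X] {μ : Measure X}
    {f : X → ℝ} (hf : AEStronglyMeasurable f μ) (h0 : ∀ z, 0 ≤ f z) {r : ℝ} (hr : 0 ≤ r)
    (h : ∫⁻ z, ENNReal.ofReal (f z) ∂μ ≤ ENNReal.ofReal r) :
    Integrable f μ ∧ ∫ z, f z ∂μ ≤ r := by
  refine ⟨⟨hf, ?_⟩, ?_⟩
  · rw [hasFiniteIntegral_iff_ofReal (Eventually.of_forall h0)]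
    exact h.trans_lt ENNReal.ofReal_lt_top
  · rw [integral_eq_lintegral_of_nonneg_ae (Eventually.of_forall h0) hf]
    exact ENNReal.toReal_le_of_le_ofReal hr h

lemma JumpKernel.exists_lipschitz_sq (hj : JumpKernel ν j C) :
    ∃ K : ℝ, 0 < K ∧ ∀ (S : Set (RN N)), S ⊆ Metric.ball 0 1 → ∀ x y : RN N,
      IntegrableOn (fun z => ‖j x z - j y z‖ ^ 2) S ν ∧
      ∫ z in S, ‖j x z - j y z‖ ^ 2 ∂ν ≤ K * ‖x - y‖ ^ 2 := by
  obtain ⟨K, hK, h⟩ := hj.lip 1 one_pos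
  refine ⟨K, hK, fun S hS x y => ?_⟩
  refine integrable_and_integral_le_of_lintegral_le
    (((hj.aestronglyMeasurable x S).sub (hj.aestronglyMeasurable y S)).norm.pow 2)
    (fun z => sq_nonneg _) (mul_nonneg hK.le (sq_nonneg _)) ?_
  exact (lintegral_mono' (Measure.restrict_mono hS le_rfl) le_rfl).trans (h x y).1

lemma JumpKernel.exists_lipschitz (hj : JumpKernel ν j C) {δ : ℝ} (hδ : 0 < δ) :
    ∃ K : ℝ, 0 < K ∧ ∀ x y : RN N,
      IntegrableOn (fun z => ‖j x z - j y z‖) (Metric.ball 0 1 \ Metric.ball 0 δ) ν ∧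
      ∫ z in Metric.ball 0 1 \ Metric.ball 0 δ, ‖j x z - j y z‖ ∂ν ≤ K * ‖x - y‖ := by
  obtain ⟨K, hK, h⟩ := hj.lip δ hδ
  refine ⟨K, hK, fun x y => ?_⟩
  exact integrable_and_integral_le_of_lintegral_le
    ((hj.aestronglyMeasurable x _).sub (hj.aestronglyMeasurable y _)).norm
    (fun z => norm_nonneg _) (mul_nonneg hK.le (norm_nonneg _)) (h x y).2

/-- A bounded measurable function of the landing point is integrable off a ball. -/
lemma JumpKernel.integrableOn_landing (hj : JumpKernel ν j C) {δ : ℝ} (hδ : 0 < δ)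
    {S : Set (RN N)} (hS : S ⊆ (Metric.ball 0 δ)ᶜ) {w : RN N → ℝ} (hw : Measurable w) {R : ℝ}
    (hR : ∀ x, |w x| ≤ R) (x : RN N) : IntegrableOn (fun z => w (x + j x z)) S ν := by
  have := hj.isFiniteMeasure_restrict hδ hS
  refine Integrable.of_bound (C := R) ?_ (Eventually.of_forall fun z => hR _)
  exact (hw.comp_aemeasurable
    ((hj.aestronglyMeasurable x S).aemeasurable.const_add x)).aestronglyMeasurable

/-- The compensator is integrable off a ball. -/
lemma JumpKernel.integrableOn_compensator (hj : JumpKernel ν j C) {δ : ℝ} (hδ : 0 < δ)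
    {S : Set (RN N)} (hS : S ⊆ (Metric.ball 0 δ)ᶜ) (x p : RN N) :
    IntegrableOn ((Metric.ball (0 : RN N) 1).indicator (fun z => (inner ℝ p (j x z) : ℝ))) S ν := by
  have := hj.isFiniteMeasure_restrict hδ hS
  refine Integrable.of_bound (C := ‖p‖ * C) ?_ (Eventually.of_forall fun z => ?_)
  · exact AEStronglyMeasurable.indicator
      (aestronglyMeasurable_const.inner (hj.aestronglyMeasurable x S)) measurableSet_ball
  · have hp := hj.pos
    by_cases hz : z ∈ Metric.ball (0 : RN N) 1
    · rw [indicator_of_mem hz]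
      have hz : ‖z‖ < 1 := by simpa using hz
      refine (norm_inner_le_norm _ _).trans ?_
      gcongr
      exact (hj.bound x z).trans (by nlinarith)
    · rw [indicator_of_notMem hz, norm_zero]; positivity

end Kernel

/-! ### Quadratic test functions and the doubled functional -/

section Doubling

variable {N : ℕ} {ν : Measure (RN N)} {j : RN N → RN N → RN N} {C : ℝ}

lemma hasGradientAt_norm_sub_sq (A : ℝ) (c x : RN N) :
    HasGradientAt (fun y => A * ‖y - c‖ ^ 2) ((2 * A) • (x - c)) x := by
  rw [hasGradientAt_iff_hasFDerivAt]
  have h := (((hasFDerivAt_id x).sub_const c).norm_sq).const_mul A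
  refine h.congr_fderiv ?_
  ext w
  simp
  ring

lemma gradient_quadratic (A B k : ℝ) (c d x : RN N) :
    gradient (fun y => A * ‖y - c‖ ^ 2 + B * ‖y - d‖ ^ 2 + k) x
      = (2 * A) • (x - c) + (2 * B) • (x - d) := by
  refine HasGradientAt.gradient ?_
  rw [hasGradientAt_iff_hasFDerivAt, map_add]
  exact ((hasGradientAt_norm_sub_sq A c x).hasFDerivAt.add
    (hasGradientAt_norm_sub_sq B d x).hasFDerivAt).add_const k

lemma contDiff_quadratic (A B : ℝ) (c d : RN N) {k : ℝ → ℝ} (hk : ContDiff ℝ 2 k) :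
    ContDiff ℝ 2 (fun q : RN N × ℝ => A * ‖q.1 - c‖ ^ 2 + B * ‖q.1 - d‖ ^ 2 + k q.2) := by
  have h1 : ∀ c : RN N, ContDiff ℝ 2 (fun q : RN N × ℝ => ‖q.1 - c‖ ^ 2) := fun c =>
    (contDiff_fst.sub contDiff_const).norm_sq ℝ
  exact ((contDiff_const.mul (h1 c)).add (contDiff_const.mul (h1 d))).add (hk.comp contDiff_snd)

lemma norm_add_sub_sq_expand (x c w : RN N) :
    ‖x + w - c‖ ^ 2 = ‖x - c‖ ^ 2 + 2 * inner ℝ (x - c) w + ‖w‖ ^ 2 := by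
  rw [show x + w - c = (x - c) + w by abel, norm_add_sq_real]

/-- The viscosity left-hand side for a quadratic test function. -/
lemma viscosityLHS_quadratic (H : RN N → RN N → ℝ) {δ : ℝ} (hδ : δ ≤ 1) (w : RN N → ℝ → ℝ)
    (A B : ℝ) (c d : RN N) (k : ℝ → ℝ) (x : RN N) (t : ℝ) :
    viscosityLHS ν j H δ w (fun y s => A * ‖y - c‖ ^ 2 + B * ‖y - d‖ ^ 2 + k s) x t =
      deriv k t - (A + B) * ∫ z in Metric.ball 0 δ, ‖j x z‖ ^ 2 ∂ν
      - nonlocalOp ν j (Metric.ball 0 δ)ᶜ (fun y => w y t) x ((2 * A) • (x - c) + (2 * B) • (x - d))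
      + H x ((2 * A) • (x - c) + (2 * B) • (x - d)) := by
  simp only [viscosityLHS, gradient_quadratic, deriv_const_add]
  congr 3
  simp only [nonlocalOp]
  rw [← integral_const_mul]
  refine setIntegral_congr_fun measurableSet_ball fun z hz => ?_
  -- Since δ ≤ 1 the compensator is active on all of B_δ and cancels the linear term of the
  -- expansion exactly.
  have hz : z ∈ Metric.ball (0 : RN N) 1 := Metric.ball_subset_ball hδ hz
  simp only [indicator_of_mem hz, norm_add_sub_sq_expand, inner_add_left, inner_smul_left,
    RCLike.conj_to_real]
  ring

/-- The functional with doubled variables. -/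
def doubling (u v : RN N → ℝ → ℝ) (μ α l : ℝ) (xb : RN N) (h : ℝ → ℝ) (x y : RN N) (t s : ℝ) : ℝ :=
  μ * u x t - v y s - α * ‖x - xb‖ ^ 2 - h t - l * ‖x - y‖ ^ 2 - l * (t - s) ^ 2

/-- A maximum point of the doubled functional whose times are interior. -/
structure IsDoublingMax (u v : RN N → ℝ → ℝ) (μ α l : ℝ) (xb : RN N) (h : ℝ → ℝ) (a b : ℝ)
    (x y : RN N) (t s : ℝ) : Prop where
  left : t ∈ Ioo a b
  right : s ∈ Ioo a b
  max : ∀ x' y', ∀ t' ∈ Icc a b, ∀ s' ∈ Icc a b,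
    doubling u v μ α l xb h x' y' t' s' ≤ doubling u v μ α l xb h x y t s

variable {H : RN N → RN N → ℝ} {u v : RN N → ℝ → ℝ} {μ α l : ℝ} {xb : RN N} {h : ℝ → ℝ} {a b : ℝ}
  {x y : RN N} {t s : ℝ}

lemma exists_time_radius (ht : t ∈ Ioo a b) :
    ∃ r : ℝ, 0 < r ∧ ∀ s, |s - t| < r → s ∈ Icc a b := by
  refine ⟨min (t - a) (b - t), lt_min (by linarith [ht.1]) (by linarith [ht.2]), fun s hs => ?_⟩
  have h1 := (abs_lt.1 (hs.trans_le (min_le_left _ _))).1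
  have h2 := (abs_lt.1 (hs.trans_le (min_le_right _ _))).2
  constructor <;> linarith

/-- With (y, s) frozen, maximality makes μ⁻¹ times the penalties a test function for u; the
inequality is then multiplied back by μ. The threshold on δ keeps the small jumps inside the
cylinder where the maximum is known, through |j| ≤ C|z|. -/
lemma IsDoublingMax.sub_ineq (hj : JumpKernel ν j C) (hu : IsViscositySubsolution ν j H u)
    (hμ : 0 < μ) (hh : ContDiff ℝ 2 h) (ha : 0 < a)
    (hm : IsDoublingMax u v μ α l xb h a b x y t s) :
    ∃ r : ℝ, 0 < r ∧ ∀ δ, 0 < δ → δ < r → δ ≤ 1 →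
      deriv h t + 2 * l * (t - s) - (α + l) * ∫ z in Metric.ball 0 δ, ‖j x z‖ ^ 2 ∂ν
      - μ * nonlocalOp ν j (Metric.ball 0 δ)ᶜ (fun y => u y t) x
          (μ⁻¹ • ((2 * α) • (x - xb) + (2 * l) • (x - y)))
      + μ * H x (μ⁻¹ • ((2 * α) • (x - xb) + (2 * l) • (x - y))) ≤ 0 := by
  obtain ⟨r, hr, hrt⟩ := exists_time_radius hm.left
  have hC := hj.pos
  refine ⟨r / C, by positivity, fun δ hδ hδr hδ1 => ?_⟩
  have hk : ContDiff ℝ 2 (fun τ => μ⁻¹ * (h τ + l * (τ - s) ^ 2)) := by fun_prop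
  have key := hu.ineq (fun y' τ => μ⁻¹ * α * ‖y' - xb‖ ^ 2 + μ⁻¹ * l * ‖y' - y‖ ^ 2
    + μ⁻¹ * (h τ + l * (τ - s) ^ 2)) (contDiff_quadratic (μ⁻¹ * α) (μ⁻¹ * l) xb y hk) x t r δ
    (ha.trans hm.left.1) hr hδ ?_ ?_
  · rw [viscosityLHS_quadratic H hδ1] at key
    have hd : deriv (fun τ => μ⁻¹ * (h τ + l * (τ - s) ^ 2)) t
        = μ⁻¹ * (deriv h t + 2 * l * (t - s)) := by
      have h1 : HasDerivAt h (deriv h t) t := (hh.differentiable (by norm_num) t).hasDerivAt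
      have h2 := ((hasDerivAt_id t).sub_const s).pow 2 |>.const_mul l
      refine ((h1.add h2).const_mul μ⁻¹).deriv.trans ?_
      simp only [id, Nat.cast_ofNat, Nat.add_one_sub_one, pow_one, mul_one]
      ring
    have hp : (2 * (μ⁻¹ * α)) • (x - xb) + (2 * (μ⁻¹ * l)) • (x - y)
        = μ⁻¹ • ((2 * α) • (x - xb) + (2 * l) • (x - y)) := by
      rw [smul_add, smul_smul, smul_smul]; congr 2 <;> ring
    rw [hd, hp] at key
    have := mul_nonpos_of_nonneg_of_nonpos hμ.le key
    refine le_trans (le_of_eq ?_) this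
    field_simp
  · intro z hz
    refine (hj.bound x z).trans_lt ?_
    have : ‖z‖ < r / C := hz.trans hδr
    rw [lt_div_iff₀ hC] at this
    linarith
  · intro y' s' _ hs' _
    have := hm.max y' y s' (hrt s' hs') s ⟨hm.right.1.le, hm.right.2.le⟩
    simp only [doubling] at this
    have h3 := mul_le_mul_of_nonneg_left this (inv_nonneg.2 hμ.le)
    have e : ∀ r : ℝ, μ⁻¹ * (μ * r) = r := fun r => by field_simp
    have e1 := e (u y' s')
    have e2 := e (u x t)
    simp only [mul_sub] at h3
    simp only [mul_add]
    linarith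

/-- The localizing penalty and h involve only (x, t), so v is tested by the doubling penalty alone.
Its gradient p = 2l(x - y) differs from μ times the gradient for u only by the small vector 2α(x -
xb). -/
lemma IsDoublingMax.super_ineq (hj : JumpKernel ν j C) (hv : IsViscositySupersolution ν j H v)
    (ha : 0 < a) (hm : IsDoublingMax u v μ α l xb h a b x y t s) :
    ∃ r : ℝ, 0 < r ∧ ∀ δ, 0 < δ → δ < r → δ ≤ 1 →
      0 ≤ 2 * l * (t - s) + l * ∫ z in Metric.ball 0 δ, ‖j y z‖ ^ 2 ∂ν
      - nonlocalOp ν j (Metric.ball 0 δ)ᶜ (fun y => v y s) y ((2 * l) • (x - y))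
      + H y ((2 * l) • (x - y)) := by
  obtain ⟨r, hr, hrt⟩ := exists_time_radius hm.right
  have hC := hj.pos
  refine ⟨r / C, by positivity, fun δ hδ hδr hδ1 => ?_⟩
  have hk : ContDiff ℝ 2 (fun τ => (-l) * (τ - t) ^ 2) := by fun_prop
  have key := hv.ineq (fun y' τ => -l * ‖y' - x‖ ^ 2 + 0 * ‖y' - x‖ ^ 2 + -l * (τ - t) ^ 2)
    (contDiff_quadratic (-l) 0 x x hk) y s r δ
    (ha.trans hm.right.1) hr hδ ?_ ?_
  · rw [viscosityLHS_quadratic H hδ1] at key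
    have hd : deriv (fun τ => (-l) * (τ - t) ^ 2) s = 2 * l * (t - s) := by
      have h2 := ((hasDerivAt_id s).sub_const t).pow 2 |>.const_mul (-l)
      refine h2.deriv.trans ?_
      simp; ring
    have hp : (2 * -l) • (y - x) + ((2 : ℝ) * 0) • (y - x) = (2 * l) • (x - y) := by
      rw [mul_zero, zero_smul, add_zero, ← neg_sub x y, smul_neg, ← neg_smul]; congr 1; ring
    rw [hd, hp] at key
    linarith
  · intro z hz
    refine (hj.bound y z).trans_lt ?_
    have : ‖z‖ < r / C := hz.trans hδr
    rw [lt_div_iff₀ hC] at this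
    linarith
  · intro y' s' _ hs' _
    have := hm.max x y' t ⟨hm.left.1.le, hm.left.2.le⟩ s' (hrt s' hs')
    simp only [doubling] at this
    rw [norm_sub_rev y' x, norm_sub_rev y x]
    nlinarith

end Doubling

/-! ### Hamiltonian and nonlocal estimates at a doubled maximum -/

section Pointwise

variable {N : ℕ} {ν : Measure (RN N)} {j : RN N → RN N → RN N} {C : ℝ}
  {H : RN N → RN N → ℝ} {u v : RN N → ℝ → ℝ} {μ α l : ℝ} {xb : RN N} {h : ℝ → ℝ} {a b : ℝ}
  {x y : RN N} {t s : ℝ}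

/-- Lower bound for the difference of Hamiltonians at a doubled point. -/
lemma hamiltonian_difference_lower {m c A b₀ L : ℝ} {ζ₁ ζ₂ : ℝ → ℝ} (hm : 1 < m) (hc : 0 ≤ c)
    (hζ₂ : ∀ s, ζ₂ s = c * |s|) (hH1 : HamiltonianH1 H m ζ₁ ζ₂)
    (hH2 : ∀ μ : ℝ, μ ∈ Ioo (0 : ℝ) 1 → ∀ x p : RN N,
      H x p - μ * H x (μ⁻¹ • p) ≤ (1 - μ) * (b₀ * (1 - m) * ‖p‖ ^ m + A))
    (hμ : μ ∈ Ioo (0 : ℝ) 1) (hL : 0 < L) {p q : RN N} (hq1 : ‖q‖ ≤ 1)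
    (hq : c * ‖q‖ ≤ (1 - μ) * (b₀ * (m - 1)) / 2 * L)
    (hζ : ζ₁ ‖x - y‖ ≤ (1 - μ) * (b₀ * (m - 1)) / 2) :
    -((1 - μ) * A) - ζ₁ ‖x - y‖ - c * ‖q‖ * (1 + L ^ (m - 1))
      ≤ μ * H x (μ⁻¹ • (q + p)) - H y p := by
  -- Taking q + p as base gradient and -q as increment makes (H1) produce powers of |q + p|, the
  -- ones that (H2) controls.
  have h1 := hH1 x y (q + p) (-q) (by simpa using hq1)
  have h2 := hH2 μ hμ x (q + p)
  rw [show q + p + -q = p by abel, hζ₂, norm_neg, abs_norm] at h1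
  set P := ‖q + p‖ with hP
  have hP0 : 0 ≤ P := norm_nonneg _
  have hPm : 0 ≤ P ^ m := Real.rpow_nonneg hP0 _
  have hPm1 : 0 ≤ P ^ (m - 1) := Real.rpow_nonneg hP0 _
  have hLm1 : 0 ≤ L ^ (m - 1) := Real.rpow_nonneg hL.le _
  have hcq : 0 ≤ c * ‖q‖ := by positivity
  -- One half of the coercive term pays for |q| P^(m-1): entirely when P ≥ L, up to the constant
  -- L^(m-1) otherwise. The other half is kept for ζ₁ P^m in `h4`.
  have key : c * ‖q‖ * P ^ (m - 1)
      ≤ (1 - μ) * (b₀ * (m - 1)) / 2 * P ^ m + c * ‖q‖ * L ^ (m - 1) := by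
    have hκ : 0 ≤ (1 - μ) * (b₀ * (m - 1)) / 2 := by
      by_contra hneg
      push Not at hneg
      nlinarith
    rcases le_total P L with hPL | hPL
    · have : P ^ (m - 1) ≤ L ^ (m - 1) := Real.rpow_le_rpow hP0 hPL (by linarith)
      have := mul_le_mul_of_nonneg_left this hcq
      nlinarith
    · have hP' : 0 < P := hL.trans_le hPL
      have e : P ^ m = P * P ^ (m - 1) := by
        rw [Real.rpow_sub_one hP'.ne']; field_simp
      have h3 : c * ‖q‖ * P ^ (m - 1) ≤ (1 - μ) * (b₀ * (m - 1)) / 2 * P * P ^ (m - 1) :=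
        mul_le_mul_of_nonneg_right (hq.trans (mul_le_mul_of_nonneg_left hPL hκ)) hPm1
      rw [e]
      nlinarith [mul_nonneg hcq hLm1]
  have h4 := mul_le_mul_of_nonneg_right hζ hPm
  nlinarith

/-- The integrand of the nonlocal difference, without compensators. -/
def jumpGap (j : RN N → RN N → RN N) (u v : RN N → ℝ → ℝ) (μ : ℝ) (x y : RN N) (t s : ℝ)
    (z : RN N) : ℝ :=
  μ * u (x + j x z) t - v (y + j y z) s - (μ * u x t - v y s)

lemma JumpKernel.integrableOn_jumpGap (hj : JumpKernel ν j C) {δ R : ℝ} (hδ : 0 < δ)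
    {S : Set (RN N)} (hS : S ⊆ (Metric.ball 0 δ)ᶜ)
    (hum : Measurable fun x => u x t) (hvm : Measurable fun x => v x s)
    (hu : ∀ x, |u x t| ≤ R) (hv : ∀ x, |v x s| ≤ R) (μ : ℝ) (x y : RN N) :
    IntegrableOn (jumpGap j u v μ x y t s) S ν := by
  have := hj.isFiniteMeasure_restrict hδ hS
  exact (((hj.integrableOn_landing hδ hS hum hu x).const_mul μ).sub
    (hj.integrableOn_landing hδ hS hvm hv y)).sub (integrable_const _)

/-- Comparison of the nonlocal terms at a maximum of the doubled functional. -/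
lemma IsDoublingMax.nonlocal_le (hj : JumpKernel ν j C)
    (hm : IsDoublingMax u v μ α l xb h a b x y t s) (hμ : 0 < μ) (hα : 0 ≤ α) (hl : 0 ≤ l)
    (hum : Measurable fun x => u x t) (hvm : Measurable fun x => v x s) {R : ℝ}
    (hu : ∀ x, |u x t| ≤ R) (hv : ∀ x, |v x s| ≤ R) {K₁ K₂ δ₀ δ : ℝ} (hδ : 0 < δ) (hδδ : δ ≤ δ₀)
    (hδ₀ : δ₀ ≤ 1)
    (hK₁ : ∀ (S : Set (RN N)), S ⊆ Metric.ball 0 1 → ∀ x y : RN N,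
      IntegrableOn (fun z => ‖j x z - j y z‖ ^ 2) S ν ∧
      ∫ z in S, ‖j x z - j y z‖ ^ 2 ∂ν ≤ K₁ * ‖x - y‖ ^ 2)
    (hK₂ : ∀ x y : RN N,
      IntegrableOn (fun z => ‖j x z - j y z‖) (Metric.ball 0 1 \ Metric.ball 0 δ₀) ν ∧
      ∫ z in Metric.ball 0 1 \ Metric.ball 0 δ₀, ‖j x z - j y z‖ ∂ν ≤ K₂ * ‖x - y‖) :
    μ * nonlocalOp ν j (Metric.ball 0 δ)ᶜ (fun y => u y t) x
          (μ⁻¹ • ((2 * α) • (x - xb) + (2 * l) • (x - y)))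
      - nonlocalOp ν j (Metric.ball 0 δ)ᶜ (fun y => v y s) y ((2 * l) • (x - y))
    ≤ α * (C ^ 2 * ∫ z in Metric.ball (0 : RN N) 1, ‖z‖ ^ 2 ∂ν)
      + (K₁ + 2 * K₂) * (l * ‖x - y‖ ^ 2)
      + ‖(2 * α) • (x - xb)‖ * C * ν.real (Metric.ball 0 δ₀)ᶜ
      + ∫ z in (Metric.ball 0 δ₀)ᶜ, jumpGap j u v μ x y t s z ∂ν := by
  set q : RN N := (2 * α) • (x - xb) with hq
  set p : RN N := (2 * l) • (x - y) with hp
  set E : Set (RN N) := (Metric.ball 0 δ)ᶜ with hE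
  set G := jumpGap j u v μ x y t s with hG
  set I₁ : RN N → ℝ := (Metric.ball (0 : RN N) 1).indicator (fun z => inner ℝ q (j x z)) with hI₁
  set I₂ : RN N → ℝ := (Metric.ball (0 : RN N) 1).indicator
    (fun z => inner ℝ p (j x z - j y z)) with hI₂
  have hδ₀pos : 0 < δ₀ := hδ.trans_le hδδ
  have hE₀ : (Metric.ball (0 : RN N) δ₀)ᶜ ⊆ E := compl_subset_compl.2 (Metric.ball_subset_ball hδδ)
  have hfin := hj.isFiniteMeasure_restrict hδ (subset_refl E)
  have hfin₀ := hj.isFiniteMeasure_restrict hδ hE₀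
  have hGi : IntegrableOn G E ν := hj.integrableOn_jumpGap hδ subset_rfl hum hvm hu hv μ x y
  have hI₁i : IntegrableOn I₁ E ν := hj.integrableOn_compensator hδ subset_rfl x q
  have hI₂e : I₂ = (Metric.ball (0 : RN N) 1).indicator (fun z => inner ℝ p (j x z))
      - (Metric.ball (0 : RN N) 1).indicator (fun z => inner ℝ p (j y z)) := by
    rw [hI₂, ← indicator_sub']
    congr 1; ext z; simp [inner_sub_right]
  have hI₂i : IntegrableOn I₂ E ν := by
    rw [hI₂e]
    exact (hj.integrableOn_compensator hδ subset_rfl x p).sub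
      (hj.integrableOn_compensator hδ subset_rfl y p)
  have hDi : IntegrableOn (fun z => G z - I₁ z - I₂ z) E ν := (hGi.sub hI₁i).sub hI₂i
  -- the difference as a single integral
  have e1 : μ * nonlocalOp ν j E (fun y => u y t) x (μ⁻¹ • (q + p))
      - nonlocalOp ν j E (fun y => v y s) y p = ∫ z in E, (G z - I₁ z - I₂ z) ∂ν := by
    have hnu : IntegrableOn (fun z => u (x + j x z) t - u x t
        - (Metric.ball (0 : RN N) 1).indicator
          (fun z => inner ℝ (μ⁻¹ • (q + p)) (j x z)) z) E ν :=
      ((hj.integrableOn_landing hδ subset_rfl hum hu x).sub (integrable_const _)).sub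
        (hj.integrableOn_compensator hδ subset_rfl x _)
    have hnv : IntegrableOn (fun z => v (y + j y z) s - v y s
        - (Metric.ball (0 : RN N) 1).indicator (fun z => inner ℝ p (j y z)) z) E ν :=
      ((hj.integrableOn_landing hδ subset_rfl hvm hv y).sub (integrable_const _)).sub
        (hj.integrableOn_compensator hδ subset_rfl y _)
    simp only [nonlocalOp]
    rw [← integral_const_mul, ← integral_sub (hnu.const_mul μ) hnv]
    refine integral_congr_ae (Eventually.of_forall fun z => ?_)
    simp only [hG, jumpGap, hI₁, hI₂]
    by_cases hz : z ∈ Metric.ball (0 : RN N) 1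
    · simp only [indicator_of_mem hz, inner_smul_left, inner_add_left, inner_sub_right,
        RCLike.conj_to_real]
      field_simp
      ring
    · simp only [indicator_of_notMem hz]
      ring
  have e2 : E \ Metric.ball 0 δ₀ = (Metric.ball (0 : RN N) δ₀)ᶜ := by
    rw [sdiff_eq]; exact inter_eq_right.2 hE₀
  rw [e1, ← integral_inter_add_sdiff measurableSet_ball hDi, e2]
  -- the annulus
  have hsub : E ∩ Metric.ball 0 δ₀ ⊆ Metric.ball (0 : RN N) 1 :=
    inter_subset_right.trans (Metric.ball_subset_ball hδ₀)
  have hann : ∫ z in E ∩ Metric.ball 0 δ₀, (G z - I₁ z - I₂ z) ∂ν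
      ≤ α * (C ^ 2 * ∫ z in Metric.ball (0 : RN N) 1, ‖z‖ ^ 2 ∂ν) + l * (K₁ * ‖x - y‖ ^ 2) := by
    have hi1 := (hj.integrableOn_jumpSq x hsub).const_mul α
    have hi2 := (hK₁ _ hsub x y).1.const_mul l
    have hmeas : MeasurableSet (E ∩ Metric.ball 0 δ₀) :=
      measurableSet_ball.compl.inter measurableSet_ball
    calc ∫ z in E ∩ Metric.ball 0 δ₀, (G z - I₁ z - I₂ z) ∂ν
        ≤ ∫ z in E ∩ Metric.ball 0 δ₀, (α * ‖j x z‖ ^ 2 + l * ‖j x z - j y z‖ ^ 2) ∂ν := by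
          refine setIntegral_mono_on (hDi.mono_set inter_subset_left) (hi1.add hi2) hmeas ?_
          intro z hz
          have hz1 := hsub hz
          simp only [hI₁, hI₂, indicator_of_mem hz1, hG, jumpGap]
          -- Both points jump with the same z, and the linear terms of the expanded penalties are
          -- exactly the compensators `I₁` and `I₂`.
          have hmx := hm.max (x + j x z) (y + j y z) t ⟨hm.left.1.le, hm.left.2.le⟩ s
            ⟨hm.right.1.le, hm.right.2.le⟩
          simp only [doubling] at hmx
          rw [show x + j x z - (y + j y z) = x + (j x z - j y z) - y by abel,
            norm_add_sub_sq_expand, norm_add_sub_sq_expand] at hmx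
          rw [hq, hp, inner_smul_left, inner_smul_left]
          simp only [RCLike.conj_to_real]
          linarith
      _ = α * ∫ z in E ∩ Metric.ball 0 δ₀, ‖j x z‖ ^ 2 ∂ν
          + l * ∫ z in E ∩ Metric.ball 0 δ₀, ‖j x z - j y z‖ ^ 2 ∂ν := by
          rw [integral_add hi1 hi2, integral_const_mul, integral_const_mul]
      _ ≤ _ := by
          gcongr
          · refine (hj.integral_jumpSq_le x hsub).trans ?_
            gcongr
            · exact Eventually.of_forall fun z => sq_nonneg _
            · exact hj.integrableOn_normSq
          · exact (hK₁ _ hsub x y).2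
  -- the exterior region
  have hext : ∫ z in (Metric.ball 0 δ₀)ᶜ, (G z - I₁ z - I₂ z) ∂ν
      ≤ ∫ z in (Metric.ball 0 δ₀)ᶜ, G z ∂ν + ‖q‖ * C * ν.real (Metric.ball 0 δ₀)ᶜ
        + ‖p‖ * (K₂ * ‖x - y‖) := by
    rw [integral_sub (f := fun z => G z - I₁ z) (g := I₂)
      ((hGi.mono_set hE₀).sub (hI₁i.mono_set hE₀)) (hI₂i.mono_set hE₀),
      integral_sub (hGi.mono_set hE₀) (hI₁i.mono_set hE₀)]
    have hb1 : -∫ z in (Metric.ball 0 δ₀)ᶜ, I₁ z ∂ν ≤ ‖q‖ * C * ν.real (Metric.ball 0 δ₀)ᶜ := by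
      refine (neg_le_abs _).trans ?_
      rw [← Real.norm_eq_abs]
      refine norm_setIntegral_le_of_norm_le_const (hj.measure_compl_ball hδ₀pos) fun z _ => ?_
      have hC := hj.pos
      by_cases hz : z ∈ Metric.ball (0 : RN N) 1
      · rw [hI₁, indicator_of_mem hz]
        have hz : ‖z‖ < 1 := by simpa using hz
        refine (norm_inner_le_norm _ _).trans ?_
        gcongr
        exact (hj.bound x z).trans (by nlinarith)
      · rw [hI₁, indicator_of_notMem hz, norm_zero]; positivity
    have hb2 : -∫ z in (Metric.ball 0 δ₀)ᶜ, I₂ z ∂ν ≤ ‖p‖ * (K₂ * ‖x - y‖) := by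
      refine (neg_le_abs _).trans ?_
      rw [hI₂, setIntegral_indicator measurableSet_ball, ← Real.norm_eq_abs]
      have hset : (Metric.ball (0 : RN N) δ₀)ᶜ ∩ Metric.ball 0 1
          = Metric.ball 0 1 \ Metric.ball 0 δ₀ := by rw [sdiff_eq, inter_comm]
      rw [hset]
      calc _ ≤ ∫ z in Metric.ball 0 1 \ Metric.ball 0 δ₀, ‖p‖ * ‖j x z - j y z‖ ∂ν :=
            norm_integral_le_of_norm_le ((hK₂ x y).1.const_mul _)
              (Eventually.of_forall fun z => norm_inner_le_norm _ _)
        _ ≤ _ := by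
            rw [integral_const_mul]
            exact mul_le_mul_of_nonneg_left (hK₂ x y).2 (norm_nonneg _)
    linarith
  -- The norm of p is not bounded as l grows, but (J2) supplies a second factor |x - y|, so only l|x
  -- - y|² appears.
  have hpn : ‖p‖ = 2 * l * ‖x - y‖ := by
    rw [hp, norm_smul, Real.norm_of_nonneg (by positivity)]
  rw [hpn] at hext
  linarith

/-- The combined viscosity inequality at a maximum of the doubled functional. -/
lemma IsDoublingMax.combined (hj : JumpKernel ν j C) (hus : IsViscositySubsolution ν j H u)
    (hvs : IsViscositySupersolution ν j H v) (hh : ContDiff ℝ 2 h) (ha : 0 < a)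
    (hm : IsDoublingMax u v μ α l xb h a b x y t s) (hμ : 0 < μ) (hα : 0 ≤ α) (hl : 0 ≤ l)
    (hum : Measurable fun x => u x t) (hvm : Measurable fun x => v x s) {R : ℝ}
    (hu : ∀ x, |u x t| ≤ R) (hv : ∀ x, |v x s| ≤ R) {K₁ K₂ δ₀ : ℝ} (hδ₀pos : 0 < δ₀)
    (hδ₀ : δ₀ ≤ 1)
    (hK₁ : ∀ (S : Set (RN N)), S ⊆ Metric.ball 0 1 → ∀ x y : RN N,
      IntegrableOn (fun z => ‖j x z - j y z‖ ^ 2) S ν ∧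
      ∫ z in S, ‖j x z - j y z‖ ^ 2 ∂ν ≤ K₁ * ‖x - y‖ ^ 2)
    (hK₂ : ∀ x y : RN N,
      IntegrableOn (fun z => ‖j x z - j y z‖) (Metric.ball 0 1 \ Metric.ball 0 δ₀) ν ∧
      ∫ z in Metric.ball 0 1 \ Metric.ball 0 δ₀, ‖j x z - j y z‖ ∂ν ≤ K₂ * ‖x - y‖) :
    deriv h t + (μ * H x (μ⁻¹ • ((2 * α) • (x - xb) + (2 * l) • (x - y)))
        - H y ((2 * l) • (x - y)))
    ≤ α * (C ^ 2 * ∫ z in Metric.ball (0 : RN N) 1, ‖z‖ ^ 2 ∂ν)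
      + (K₁ + 2 * K₂) * (l * ‖x - y‖ ^ 2)
      + ‖(2 * α) • (x - xb)‖ * C * ν.real (Metric.ball 0 δ₀)ᶜ
      + ∫ z in (Metric.ball 0 δ₀)ᶜ, jumpGap j u v μ x y t s z ∂ν := by
  obtain ⟨r₁, hr₁, h₁⟩ := hm.sub_ineq hj hus hμ hh ha
  obtain ⟨r₂, hr₂, h₂⟩ := hm.super_ineq hj hvs ha
  refine le_of_forall_pos_le_add fun e he => ?_
  -- The sub- and supersolution inequalities contribute (α + l) and l times C² ∫_{B_δ} |z|²; the
  -- added 1 keeps the divisor positive.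
  have hD : 0 < (α + l + l) * C ^ 2 + 1 := by positivity
  obtain ⟨δ, hδ, hδr, hδe⟩ := hj.exists_small_ball (e := e / ((α + l + l) * C ^ 2 + 1))
    (by positivity) (min (min r₁ r₂) δ₀) (by positivity)
  have hδ₀' : δ ≤ δ₀ := hδr.le.trans (min_le_right _ _)
  have hr := hδr.trans_le (min_le_left _ _)
  have i₁ := h₁ δ hδ (hr.trans_le (min_le_left _ _)) (hδ₀'.trans hδ₀)
  have i₂ := h₂ δ hδ (hr.trans_le (min_le_right _ _)) (hδ₀'.trans hδ₀)
  have i₃ := hm.nonlocal_le hj hμ hα hl hum hvm hu hv hδ hδ₀' hδ₀ hK₁ hK₂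
  have hs : Metric.ball (0 : RN N) δ ⊆ Metric.ball 0 1 :=
    Metric.ball_subset_ball (hδ₀'.trans hδ₀)
  have j₁ := mul_le_mul_of_nonneg_left (hj.integral_jumpSq_le x hs) (add_nonneg hα hl)
  have j₂ := mul_le_mul_of_nonneg_left (hj.integral_jumpSq_le y hs) hl
  rw [lt_div_iff₀ hD] at hδe
  have hW : 0 ≤ ∫ z in Metric.ball (0 : RN N) δ, ‖z‖ ^ 2 ∂ν :=
    integral_nonneg fun z => sq_nonneg _
  linarith

end Pointwise

/-! ### Existence of doubled maxima and large penalization -/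

section Limit

variable {N : ℕ} {u v : RN N → ℝ → ℝ} {μ α : ℝ} {xb : RN N} {h : ℝ → ℝ} {a b : ℝ}

lemma eventually_lt_of_usc {ι : Type*} {F : Filter ι}
    (hu : UpperSemicontinuousOn (fun q : RN N × ℝ => u q.1 q.2) (univ ×ˢ Ici 0))
    {x : ι → RN N} {t : ι → ℝ} {x' : RN N} {t' : ℝ} (hx : Tendsto x F (𝓝 x'))
    (ht : Tendsto t F (𝓝 t')) (ht0 : ∀ᶠ i in F, 0 ≤ t i) (ht' : 0 ≤ t') {e : ℝ} (he : 0 < e) :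
    ∀ᶠ i in F, u (x i) (t i) < u x' t' + e := by
  have h1 := hu (x', t') ⟨mem_univ _, ht'⟩ (u x' t' + e) (lt_add_of_pos_right _ he)
  have h2 : Tendsto (fun i => (x i, t i)) F (𝓝[univ ×ˢ Ici 0] (x', t')) :=
    tendsto_nhdsWithin_iff.2 ⟨hx.prodMk_nhds ht, ht0.mono fun i hi => ⟨mem_univ _, hi⟩⟩
  exact h2.eventually h1

lemma eventually_gt_of_lsc {ι : Type*} {F : Filter ι}
    (hv : LowerSemicontinuousOn (fun q : RN N × ℝ => v q.1 q.2) (univ ×ˢ Ici 0))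
    {x : ι → RN N} {t : ι → ℝ} {x' : RN N} {t' : ℝ} (hx : Tendsto x F (𝓝 x'))
    (ht : Tendsto t F (𝓝 t')) (ht0 : ∀ᶠ i in F, 0 ≤ t i) (ht' : 0 ≤ t') {e : ℝ} (he : 0 < e) :
    ∀ᶠ i in F, v x' t' - e < v (x i) (t i) := by
  have h1 := hv (x', t') ⟨mem_univ _, ht'⟩ (v x' t' - e) (sub_lt_self _ he)
  have h2 : Tendsto (fun i => (x i, t i)) F (𝓝[univ ×ˢ Ici 0] (x', t')) :=
    tendsto_nhdsWithin_iff.2 ⟨hx.prodMk_nhds ht, ht0.mono fun i hi => ⟨mem_univ _, hi⟩⟩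
  exact h2.eventually h1

lemma upperSemicontinuousOn_doubling
    (hu : UpperSemicontinuousOn (fun q : RN N × ℝ => u q.1 q.2) (univ ×ˢ Ici 0))
    (hv : LowerSemicontinuousOn (fun q : RN N × ℝ => v q.1 q.2) (univ ×ˢ Ici 0))
    (hμ : 0 < μ) (hh : Continuous h) (l : ℝ) (ha : 0 ≤ a) (K : Set (RN N × RN N)) :
    UpperSemicontinuousOn (fun q : (RN N × RN N) × ℝ × ℝ =>
      doubling u v μ α l xb h q.1.1 q.1.2 q.2.1 q.2.2) (K ×ˢ Icc a b ×ˢ Icc a b) := by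
  intro q hq r hr
  obtain ⟨⟨x, y⟩, t, s⟩ := q
  obtain ⟨-, ht, hs⟩ := hq
  set F := 𝓝[K ×ˢ Icc a b ×ˢ Icc a b] (((x, y), t, s) : (RN N × RN N) × ℝ × ℝ)
  have hF : Tendsto id F (𝓝 ((x, y), t, s)) := tendsto_id.mono_left nhdsWithin_le_nhds
  have hmem : ∀ᶠ q in F, q ∈ K ×ˢ Icc a b ×ˢ Icc a b := self_mem_nhdsWithin
  have hc : Tendsto (fun q : (RN N × RN N) × ℝ × ℝ => - α * ‖q.1.1 - xb‖ ^ 2 - h q.2.1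
      - l * ‖q.1.1 - q.1.2‖ ^ 2 - l * (q.2.1 - q.2.2) ^ 2) F
      (𝓝 (- α * ‖x - xb‖ ^ 2 - h t - l * ‖x - y‖ ^ 2 - l * (t - s) ^ 2)) := by
    have : Continuous (fun q : (RN N × RN N) × ℝ × ℝ => - α * ‖q.1.1 - xb‖ ^ 2 - h q.2.1
      - l * ‖q.1.1 - q.1.2‖ ^ 2 - l * (q.2.1 - q.2.2) ^ 2) := by fun_prop
    exact (this.tendsto ((x, y), t, s)).comp hF
  have e0 : 0 < (r - doubling u v μ α l xb h x y t s) / 3 := by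
    have : doubling u v μ α l xb h x y t s < r := hr
    linarith
  set e := (r - doubling u v μ α l xb h x y t s) / 3 with he
  have hx : Tendsto (fun q : (RN N × RN N) × ℝ × ℝ => q.1.1) F (𝓝 x) :=
    ((continuous_fst.comp continuous_fst).tendsto ((x, y), t, s)).comp hF
  have hy : Tendsto (fun q : (RN N × RN N) × ℝ × ℝ => q.1.2) F (𝓝 y) :=
    ((continuous_snd.comp continuous_fst).tendsto ((x, y), t, s)).comp hF
  have ht' : Tendsto (fun q : (RN N × RN N) × ℝ × ℝ => q.2.1) F (𝓝 t) :=
    ((continuous_fst.comp continuous_snd).tendsto ((x, y), t, s)).comp hF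
  have hs' : Tendsto (fun q : (RN N × RN N) × ℝ × ℝ => q.2.2) F (𝓝 s) :=
    ((continuous_snd.comp continuous_snd).tendsto ((x, y), t, s)).comp hF
  filter_upwards [eventually_lt_of_usc hu hx ht' (hmem.mono fun q hq => ha.trans hq.2.1.1)
      (ha.trans ht.1) (e := e / μ) (by positivity),
    eventually_gt_of_lsc hv hy hs' (hmem.mono fun q hq => ha.trans hq.2.2.1)
      (ha.trans hs.1) e0, hc.eventually (gt_mem_nhds (lt_add_of_pos_right _ e0))] with q h1 h2 h3
  have h1' := mul_lt_mul_of_pos_left h1 hμ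
  rw [mul_add, mul_div_cancel₀ _ hμ.ne'] at h1'
  have : doubling u v μ α l xb h x y t s + 3 * e = r := by rw [he]; ring
  simp only [doubling] at this ⊢
  linarith

/-- Existence of a global maximum of the doubled functional, given a reduction to bounded `x`. -/
lemma exists_doubling_max
    (hu : UpperSemicontinuousOn (fun q : RN N × ℝ => u q.1 q.2) (univ ×ˢ Ici 0))
    (hv : LowerSemicontinuousOn (fun q : RN N × ℝ => v q.1 q.2) (univ ×ˢ Ici 0))
    (hμ : 0 < μ) (hh : Continuous h) (ha : 0 ≤ a) (hab : a ≤ b) {R ρ : ℝ} (hR : 0 ≤ R)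
    (hvR : ∀ x, ∀ t ∈ Icc a b, |v x t| ≤ R) {l : ℝ} (hl : 1 ≤ l)
    (hred : ∀ x y, ∀ t ∈ Icc a b, ∀ s ∈ Icc a b, ∃ x' y', ‖x'‖ ≤ ρ ∧
      doubling u v μ α l xb h x y t s ≤ doubling u v μ α l xb h x' y' t s) :
    ∃ x y t s, t ∈ Icc a b ∧ s ∈ Icc a b ∧ ‖x‖ ≤ ρ ∧ ‖y‖ ≤ ρ + (2 * R + 1) ∧
      ∀ x' y', ∀ t' ∈ Icc a b, ∀ s' ∈ Icc a b,
        doubling u v μ α l xb h x' y' t' s' ≤ doubling u v μ α l xb h x y t s := by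
  set D := 2 * R + 1 with hD
  set K : Set (RN N × RN N) := Metric.closedBall 0 ρ ×ˢ Metric.closedBall 0 (ρ + D) with hK
  have hred' : ∀ x y, ∀ t ∈ Icc a b, ∀ s ∈ Icc a b, ∃ x' y', (x', y') ∈ K ∧
      doubling u v μ α l xb h x y t s ≤ doubling u v μ α l xb h x' y' t s := by
    intro x y t ht s hs
    obtain ⟨x', y', hx', hle⟩ := hred x y t ht s hs
    -- If y' is farther than D from x', moving it onto x' costs at most 2R through v and gains at
    -- least D² ≥ 2R from the penalty.
    by_cases hxy : ‖x' - y'‖ ≤ D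
    · refine ⟨x', y', ⟨by simpa using hx', ?_⟩, hle⟩
      have : ‖y'‖ ≤ ‖x'‖ + ‖x' - y'‖ := by
        have := norm_sub_le x' (x' - y'); simpa using this
      simp only [Metric.mem_closedBall, dist_zero_right]
      linarith
    · refine ⟨x', x', ⟨by simpa using hx', ?_⟩, hle.trans ?_⟩
      · simp only [Metric.mem_closedBall, dist_zero_right]; linarith
      · push Not at hxy
        have h1 := (abs_le.1 (hvR y' s hs)).1
        have h2 := (abs_le.1 (hvR x' s hs)).2
        have h3 : D ^ 2 ≤ ‖x' - y'‖ ^ 2 := by gcongr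
        have h4 : 2 * R ≤ D ^ 2 := by rw [hD]; nlinarith
        have h5 : ‖x' - y'‖ ^ 2 ≤ l * ‖x' - y'‖ ^ 2 := le_mul_of_one_le_left (sq_nonneg _) hl
        simp only [doubling, sub_self, norm_zero]
        linarith
  have hne : (K ×ˢ Icc a b ×ˢ Icc a b).Nonempty := by
    obtain ⟨x', y', hK', -⟩ := hred' 0 0 a ⟨le_rfl, hab⟩ a ⟨le_rfl, hab⟩
    exact ⟨((x', y'), a, a), hK', ⟨le_rfl, hab⟩, ⟨le_rfl, hab⟩⟩
  have hcomp : IsCompact (K ×ˢ Icc a b ×ˢ Icc a b) :=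
    ((isCompact_closedBall _ _).prod (isCompact_closedBall _ _)).prod
      (isCompact_Icc.prod isCompact_Icc)
  obtain ⟨⟨⟨x, y⟩, t, s⟩, ⟨⟨hx, hy⟩, ht, hs⟩, hmax⟩ :=
    (upperSemicontinuousOn_doubling (α := α) (xb := xb) hu hv hμ hh l ha K).exists_isMaxOn hne hcomp
  refine ⟨x, y, t, s, ht, hs, by simpa using hx, by simpa using hy, fun x' y' t' ht' s' hs' => ?_⟩
  obtain ⟨x₁, y₁, hK₁, hle⟩ := hred' x' y' t' ht' s' hs'
  exact hle.trans (hmax (show ((x₁, y₁), t', s') ∈ _ from ⟨hK₁, ht', hs'⟩))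

/-- The limit of doubled maximum points as the penalization parameter tends to infinity. -/
lemma exists_isDoublingMax
    (hu : UpperSemicontinuousOn (fun q : RN N × ℝ => u q.1 q.2) (univ ×ˢ Ici 0))
    (hv : LowerSemicontinuousOn (fun q : RN N × ℝ => v q.1 q.2) (univ ×ˢ Ici 0))
    (hμ : 0 < μ) (hμ1 : μ ≤ 1) (hα : 0 ≤ α) (hh : Continuous h) (ha : 0 ≤ a) {R ρ M θ : ℝ}
    (hR : 0 ≤ R) (huR : ∀ x, ∀ t ∈ Icc a b, |u x t| ≤ R) (hvR : ∀ x, ∀ t ∈ Icc a b, |v x t| ≤ R)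
    (hM : ∀ x, ∀ t ∈ Icc a b, u x t - v x t ≤ M + θ * t)
    (hred : ∀ l : ℝ, 1 ≤ l → ∀ x y, ∀ t ∈ Icc a b, ∀ s ∈ Icc a b, ∃ x' y', ‖x'‖ ≤ ρ ∧
      doubling u v μ α l xb h x y t s ≤ doubling u v μ α l xb h x' y' t s)
    {tb : ℝ} (htb : tb ∈ Icc a b)
    (hbdry : ∀ x, ∀ t, t = a ∨ t = b → μ * u x t - v x t - α * ‖x - xb‖ ^ 2 - h t
      < μ * u xb tb - v xb tb - h tb)
    {η : ℝ} (hη : 0 < η) :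
    ∃ l x y t s, 0 < l ∧ IsDoublingMax u v μ α l xb h a b x y t s ∧ ‖x‖ ≤ ρ ∧ ‖x - y‖ < η ∧
      |t - s| < η ∧ l * ‖x - y‖ ^ 2 < η ∧ u x t - v y s ≤ M + θ * t + η ∧
      μ * u xb tb - v xb tb - h tb ≤ μ * u x t - v y s - α * ‖x - xb‖ ^ 2 - h t := by
  have hab : a ≤ b := htb.1.trans htb.2
  have hex : ∀ k : ℕ, _ := fun k : ℕ => exists_doubling_max (l := (k : ℝ) + 1) (α := α) (xb := xb)
    hu hv hμ hh ha hab hR hvR (by simp) (hred _ (by simp))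
  choose x y t s ht hs hx hy hmax using hex
  have hcomp : IsCompact ((Metric.closedBall (0 : RN N) ρ ×ˢ
      Metric.closedBall (0 : RN N) (ρ + (2 * R + 1))) ×ˢ Icc a b ×ˢ Icc a b) :=
    ((isCompact_closedBall _ _).prod (isCompact_closedBall _ _)).prod
      (isCompact_Icc.prod isCompact_Icc)
  obtain ⟨⟨⟨x', y'⟩, t', s'⟩, ⟨-, ht', hs'⟩, φ, hφ, hlim⟩ := hcomp.tendsto_subseq
    (x := fun k => ((x k, y k), t k, s k))
    (fun k => ⟨⟨by simpa using hx k, by simpa using hy k⟩, ht k, hs k⟩)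
  have lx : Tendsto (fun k => x (φ k)) atTop (𝓝 x') :=
    ((continuous_fst.comp continuous_fst).tendsto ((x', y'), t', s')).comp hlim
  have ly : Tendsto (fun k => y (φ k)) atTop (𝓝 y') :=
    ((continuous_snd.comp continuous_fst).tendsto ((x', y'), t', s')).comp hlim
  have lt : Tendsto (fun k => t (φ k)) atTop (𝓝 t') :=
    ((continuous_fst.comp continuous_snd).tendsto ((x', y'), t', s')).comp hlim
  have ls : Tendsto (fun k => s (φ k)) atTop (𝓝 s') :=
    ((continuous_snd.comp continuous_snd).tendsto ((x', y'), t', s')).comp hlim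
  -- the anchor gives a lower bound
  have hanchor : ∀ k : ℕ, μ * u xb tb - v xb tb - h tb + ((k : ℝ) + 1) * ‖x k - y k‖ ^ 2
      + ((k : ℝ) + 1) * (t k - s k) ^ 2
      ≤ μ * u (x k) (t k) - v (y k) (s k) - α * ‖x k - xb‖ ^ 2 - h (t k) := by
    intro k
    have := hmax k xb xb tb htb tb htb
    simp only [doubling, sub_self, norm_zero] at this
    linarith
  obtain ⟨c, hc⟩ := (isCompact_Icc (a := a) (b := b)).bddBelow_image hh.continuousOn
  have hbound : ∀ k : ℕ, ((k : ℝ) + 1) * (‖x k - y k‖ ^ 2 + (t k - s k) ^ 2)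
      ≤ 2 * R - c - (μ * u xb tb - v xb tb - h tb) := by
    intro k
    have h1 := hanchor k
    have h2 : c ≤ h (t k) := hc (mem_image_of_mem h (ht k))
    have h3 := (abs_le.1 (huR (x k) (t k) (ht k))).2
    have h4 := (abs_le.1 (hvR (y k) (s k) (hs k))).1
    have h5 : 0 ≤ α * ‖x k - xb‖ ^ 2 := by positivity
    have h6 : μ * u (x k) (t k) ≤ R := by nlinarith
    linarith
  set B := 2 * R - c - (μ * u xb tb - v xb tb - h tb) with hB
  have hB0 : Tendsto (fun k : ℕ => B / ((φ k : ℝ) + 1)) atTop (𝓝 0) := by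
    have h1 : Tendsto (fun k : ℕ => B / ((k : ℝ) + 1)) atTop (𝓝 0) :=
      tendsto_const_div_atTop_nhds_zero_nat B |>.comp (tendsto_add_atTop_nat 1) |>.congr
        fun k => by simp
    exact h1.comp hφ.tendsto_atTop
  have hsum : ∀ k, ‖x (φ k) - y (φ k)‖ ^ 2 + (t (φ k) - s (φ k)) ^ 2 ≤ B / ((φ k : ℝ) + 1) := by
    intro k
    rw [le_div_iff₀ (by positivity)]
    linarith [hbound (φ k)]
  have hsum' : ‖x' - y'‖ ^ 2 + (t' - s') ^ 2 ≤ 0 :=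
    le_of_tendsto_of_tendsto' (((lx.sub ly).norm.pow 2).add ((lt.sub ls).pow 2)) hB0 hsum
  have hxy : x' = y' := by
    have : ‖x' - y'‖ ^ 2 = 0 := le_antisymm (by nlinarith [sq_nonneg (t' - s')]) (sq_nonneg _)
    exact sub_eq_zero.1 (norm_eq_zero.1 (pow_eq_zero_iff (by norm_num) |>.1 this))
  have hts : t' = s' := by
    have : (t' - s') ^ 2 = 0 := le_antisymm (by nlinarith [sq_nonneg ‖x' - y'‖]) (sq_nonneg _)
    exact sub_eq_zero.1 (pow_eq_zero_iff (by norm_num) |>.1 this)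
  subst hxy
  subst hts
  have hu_ev : ∀ e : ℝ, 0 < e → ∀ᶠ k in atTop, u (x (φ k)) (t (φ k)) < u x' t' + e := fun e he =>
    eventually_lt_of_usc hu lx lt (Eventually.of_forall fun k => ha.trans (ht _).1)
      (ha.trans ht'.1) he
  have hv_ev : ∀ e : ℝ, 0 < e → ∀ᶠ k in atTop, v x' t' - e < v (y (φ k)) (s (φ k)) := fun e he =>
    eventually_gt_of_lsc hv ly ls (Eventually.of_forall fun k => ha.trans (hs _).1)
      (ha.trans ht'.1) he
  have hΨ : ∀ e : ℝ, 0 < e → ∀ᶠ k in atTop, μ * u (x (φ k)) (t (φ k)) - v (y (φ k)) (s (φ k))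
      - α * ‖x (φ k) - xb‖ ^ 2 - h (t (φ k))
      < μ * u x' t' - v x' t' - α * ‖x' - xb‖ ^ 2 - h t' + e := by
    intro e he
    have l1 : Tendsto (fun k => α * ‖x (φ k) - xb‖ ^ 2 + h (t (φ k))) atTop
        (𝓝 (α * ‖x' - xb‖ ^ 2 + h t')) :=
      (((lx.sub_const xb).norm.pow 2).const_mul α).add ((hh.tendsto t').comp lt)
    filter_upwards [hu_ev (e / 3) (by positivity), hv_ev (e / 3) (by positivity),
      l1.eventually (lt_mem_nhds (sub_lt_self _ (show 0 < e / 3 by positivity)))] with k h1 h2 h3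
    have h4 : μ * u (x (φ k)) (t (φ k)) ≤ μ * u x' t' + e / 3 := by nlinarith
    linarith
  -- A limit time at an endpoint would push the functional strictly below its value at the anchor
  -- (xb, tb), by semicontinuity and `hbdry`.
  have hint : t' ∈ Ioo a b := by
    have hne : ∀ r, r = a ∨ r = b → t' ≠ r := by
      rintro r hr rfl
      have h1 := hbdry x' t' hr
      obtain ⟨k, hk⟩ := (hΨ _ (sub_pos.2 h1)).exists
      have h2 := hanchor (φ k)
      have : 0 ≤ ((φ k : ℝ) + 1) * ‖x (φ k) - y (φ k)‖ ^ 2 := by positivity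
      have : 0 ≤ ((φ k : ℝ) + 1) * (t (φ k) - s (φ k)) ^ 2 := by positivity
      linarith
    exact ⟨lt_of_le_of_ne ht'.1 (hne a (Or.inl rfl)).symm, lt_of_le_of_ne ht'.2 (hne b (Or.inr rfl))⟩
  have hIoo : Ioo a b ∈ 𝓝 t' := Ioo_mem_nhds hint.1 hint.2
  have lxy : Tendsto (fun k => ‖x (φ k) - y (φ k)‖) atTop (𝓝 0) := by
    simpa using (lx.sub ly).norm
  have lts : Tendsto (fun k => |t (φ k) - s (φ k)|) atTop (𝓝 0) := by
    simpa using (lt.sub ls).abs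
  obtain ⟨k, k1, k2, k3, k4, k5, k6, k7, k8⟩ := ((lt.eventually hIoo).and <| (ls.eventually hIoo).and <|
    (lxy.eventually (gt_mem_nhds hη)).and <| (lts.eventually (gt_mem_nhds hη)).and <|
    (hΨ η hη).and <| (hu_ev (η / 3) (by positivity)).and <| (hv_ev (η / 3) (by positivity)).and
    ((lt.const_mul θ).eventually
      (lt_mem_nhds (sub_lt_self _ (show 0 < η / 3 by positivity))))).exists
  have hpen : 0 ≤ ((φ k : ℝ) + 1) * (t (φ k) - s (φ k)) ^ 2 := by positivity
  have hpen' : 0 ≤ ((φ k : ℝ) + 1) * ‖x (φ k) - y (φ k)‖ ^ 2 := by positivity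
  refine ⟨(φ k : ℝ) + 1, x (φ k), y (φ k), t (φ k), s (φ k), by positivity, ⟨k1, k2, hmax _⟩,
    hx _, k3, k4, ?_, ?_, ?_⟩
  -- Comparison with the collapsed limit point bounds l|x - y|² by the excess over the limit value,
  -- which is eventually below η.
  · have := hmax (φ k) x' x' t' ht' t' ht'
    simp only [doubling, sub_self, norm_zero] at this
    linarith
  · linarith [hM x' t' ht']
  · linarith [hanchor (φ k)]

end Limit

/-! ### Linearization and the limit μ → 1 -/

section LimitPoint

variable {N : ℕ} {ν : Measure (RN N)} {j : RN N → RN N → RN N} {C : ℝ}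
  {H : RN N → RN N → ℝ} {u v : RN N → ℝ → ℝ} {xb : RN N} {a b : ℝ}

lemma measurable_slice_of_usc
    (hu : UpperSemicontinuousOn (fun q : RN N × ℝ => u q.1 q.2) (univ ×ˢ Ici 0)) {t : ℝ}
    (ht : 0 ≤ t) : Measurable fun x => u x t := by
  refine UpperSemicontinuous.measurable fun x r hr => ?_
  have h2 : Tendsto (fun x' => (x', t)) (𝓝 x) (𝓝[univ ×ˢ Ici 0] (x, t)) :=
    tendsto_nhdsWithin_iff.2 ⟨tendsto_id.prodMk_nhds tendsto_const_nhds,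
      Eventually.of_forall fun i => ⟨mem_univ _, ht⟩⟩
  exact h2.eventually (hu (x, t) ⟨mem_univ _, ht⟩ r hr)

lemma measurable_slice_of_lsc
    (hv : LowerSemicontinuousOn (fun q : RN N × ℝ => v q.1 q.2) (univ ×ˢ Ici 0)) {t : ℝ}
    (ht : 0 ≤ t) : Measurable fun x => v x t := by
  refine LowerSemicontinuous.measurable fun x r hr => ?_
  have h2 : Tendsto (fun x' => (x', t)) (𝓝 x) (𝓝[univ ×ˢ Ici 0] (x, t)) :=
    tendsto_nhdsWithin_iff.2 ⟨tendsto_id.prodMk_nhds tendsto_const_nhds,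
      Eventually.of_forall fun i => ⟨mem_univ _, ht⟩⟩
  exact h2.eventually (hv (x, t) ⟨mem_univ _, ht⟩ r hr)

lemma IsModulus.exists_lt {ζ : ℝ → ℝ} (hζ : IsModulus ζ) {e : ℝ} (he : 0 < e) :
    ∃ η : ℝ, 0 < η ∧ ∀ r, 0 ≤ r → r < η → ζ r < e := by
  have h1 := hζ.cont.eventually (gt_mem_nhds (show ζ 0 < e by rwa [hζ.zero]))
  rw [Metric.nhdsWithin_basis_ball.eventually_iff] at h1
  obtain ⟨η, hη, h⟩ := h1
  exact ⟨η, hη, fun r hr0 hr => h ⟨by simpa [abs_of_nonneg hr0] using hr, hr0⟩⟩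

/-- Doubled points for the linearization `μ u - v`, with an error of order `1 - μ`. -/
lemma exists_approximate_points {m c A b₀ : ℝ} {ζ₁ ζ₂ : ℝ → ℝ} (hj : JumpKernel ν j C)
    (hus : IsViscositySubsolution ν j H u) (hvs : IsViscositySupersolution ν j H v)
    (hm : 1 < m) (hc : 0 < c) (hζ₁ : IsModulus ζ₁)
    (hζ₂ : ∀ s, ζ₂ s = c * |s|) (hH1 : HamiltonianH1 H m ζ₁ ζ₂) (hb₀ : 0 < b₀)
    (hH2 : ∀ μ : ℝ, μ ∈ Ioo (0 : ℝ) 1 → ∀ x p : RN N,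
      H x p - μ * H x (μ⁻¹ • p) ≤ (1 - μ) * (b₀ * (1 - m) * ‖p‖ ^ m + A))
    (ha : 0 < a) {R K θ tb : ℝ} (hR : 0 ≤ R)
    (huR : ∀ x, ∀ t ∈ Icc a b, |u x t| ≤ R) (hvR : ∀ x, ∀ t ∈ Icc a b, |v x t| ≤ R)
    (htb : tb ∈ Icc a b)
    (hM : ∀ x, ∀ t ∈ Icc a b, u x t - v x t ≤ u xb tb - v xb tb + θ * (t - tb))
    (hK : 0 < K)
    (hbdry : ∀ᶠ μ in 𝓝[<] (1 : ℝ), ∀ x, ∀ t, t = a ∨ t = b → μ * u x t - v x t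
      - K * (1 - μ) * ‖x - xb‖ ^ 2 - (θ * (t - tb) + K * (1 - μ) * (t - tb) ^ 2)
      < μ * u xb tb - v xb tb)
    {δ₀ : ℝ} (hδ₀pos : 0 < δ₀) (hδ₀ : δ₀ ≤ 1) :
    ∃ Q : ℝ, ∀ᶠ μ in 𝓝[<] (1 : ℝ), ∃ x y t s, t ∈ Icc a b ∧ s ∈ Icc a b ∧ ‖x - y‖ < 1 - μ ∧
      |t - s| < 1 - μ ∧ K * (‖x - xb‖ ^ 2 + (t - tb) ^ 2) ≤ 1 + 2 * R ∧
      u xb tb - v xb tb + θ * (t - tb) - (1 - μ) * R ≤ μ * u x t - v y s ∧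
      θ ≤ (1 - μ) * Q + ∫ z in (Metric.ball 0 δ₀)ᶜ, jumpGap j u v μ x y t s z ∂ν := by
  obtain ⟨K₁, hK₁pos, hK₁⟩ := hj.exists_lipschitz_sq
  obtain ⟨K₂, hK₂pos, hK₂⟩ := hj.exists_lipschitz hδ₀pos
  set β := b₀ * (m - 1) with hβ
  have hβpos : 0 < β := mul_pos hb₀ (by linarith)
  -- Bounds 2K|x - xb| and -2K(t - tb), by 2r ≤ 1 + r² and the localization estimate `hloc`.
  set L₀ := K + (1 + 2 * R) with hL₀
  have hL₀pos : 0 < L₀ := by positivity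
  -- Chosen so that β L / 2 = c L₀. Since |q| ≤ (1 - μ) L₀, the threshold separating small from
  -- large gradients is then independent of μ.
  set L := 2 * c * L₀ / β with hL
  have hLpos : 0 < L := by positivity
  set V := ∫ z in Metric.ball (0 : RN N) 1, ‖z‖ ^ 2 ∂ν with hV
  set n₀ := ν.real (Metric.ball 0 δ₀)ᶜ with hn₀
  have hn₀' : 0 ≤ n₀ := measureReal_nonneg
  have hC := hj.pos
  refine ⟨L₀ + A + 1 + c * L₀ * (1 + L ^ (m - 1)) + K * (C ^ 2 * V) + 1 + L₀ * C * n₀, ?_⟩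
  have hnear : Ioo (max 0 (1 - 1 / L₀)) 1 ∈ 𝓝[<] (1 : ℝ) := by
    refine Ioo_mem_nhdsLT (max_lt one_pos ?_)
    have : 0 < 1 / L₀ := by positivity
    linarith
  filter_upwards [hbdry, hnear] with μ hμb hμn
  have hμ0 : 0 < μ := (le_max_left _ _).trans_lt hμn.1
  have hμ1 : μ < 1 := hμn.2
  have hμL : (1 - μ) * L₀ ≤ 1 := by
    have := (le_max_right _ _).trans_lt hμn.1
    have h2 : 1 - μ ≤ 1 / L₀ := by linarith
    rwa [le_div_iff₀ hL₀pos] at h2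
  set κ := 1 - μ with hκ
  have hκ0 : 0 < κ := by linarith
  set h : ℝ → ℝ := fun t => θ * (t - tb) + K * κ * (t - tb) ^ 2 with hh
  have hhc : ContDiff ℝ 2 h := by rw [hh]; fun_prop
  obtain ⟨η₁, hη₁, hmod⟩ := hζ₁.exists_lt (show 0 < min (κ * β / 2) κ by positivity)
  -- The doubling accuracy is fixed after μ, so that the ζ₁ term, |x - y|, |t - s| and (K₁ + 2K₂)
  -- l|x - y|² are all at most 1 - μ.
  set η := min η₁ (min κ (κ / (K₁ + 2 * K₂))) with hη
  have hηpos : 0 < η := by positivity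
  have hα : 0 < K * κ := by positivity
  -- Beyond this radius the penalty α|x - xb|² is at least 4R, which outweighs the possible gain in
  -- μu - v over the pair (xb, xb).
  have hred : ∀ l : ℝ, 1 ≤ l → ∀ x y, ∀ t ∈ Icc a b, ∀ s ∈ Icc a b, ∃ x' y',
      ‖x'‖ ≤ ‖xb‖ + (4 * R / (K * κ) + 1) ∧
      doubling u v μ (K * κ) l xb h x y t s ≤ doubling u v μ (K * κ) l xb h x' y' t s := by
    intro l hl x y t ht s hs
    have hr : 0 ≤ 4 * R / (K * κ) := by positivity
    by_cases hx : ‖x - xb‖ ≤ 4 * R / (K * κ) + 1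
    · refine ⟨x, y, ?_, le_rfl⟩
      have := norm_add_le xb (x - xb)
      rw [add_sub_cancel] at this
      linarith
    · refine ⟨xb, xb, by linarith, ?_⟩
      push Not at hx
      have h1 : 4 * R / (K * κ) ≤ ‖x - xb‖ ^ 2 := by nlinarith
      rw [div_le_iff₀ hα] at h1
      have h2 := (abs_le.1 (huR x t ht)).2
      have h3 := (abs_le.1 (huR xb t ht)).1
      have h4 := (abs_le.1 (hvR y s hs)).1
      have h5 := (abs_le.1 (hvR xb s hs)).2
      have h6 : 0 ≤ l * ‖x - y‖ ^ 2 := by positivity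
      have h7 : μ * (u x t - u xb t) ≤ 2 * R :=
        (mul_le_mul_of_nonneg_left (show u x t - u xb t ≤ 2 * R by linarith) hμ0.le).trans
          (mul_le_of_le_one_left (by positivity) hμ1.le)
      simp only [doubling, sub_self, norm_zero]
      linarith
  have htb0 : h tb = 0 := by simp [hh]
  obtain ⟨l, x, y, t, s, hl, hmax, -, hxy, hts, hlxy, hMη, hanc⟩ := exists_isDoublingMax
    (M := u xb tb - v xb tb - θ * tb) (θ := θ) (xb := xb) (tb := tb) (h := h)
    hus.usc hvs.lsc hμ0 hμ1.le hα.le hhc.continuous ha.le hR huR hvR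
    (fun x t ht => (hM x t ht).trans (by linarith)) hred htb
    (fun x t ht => by rw [htb0, sub_zero]; exact hμb x t ht) hηpos
  have ht : t ∈ Icc a b := ⟨hmax.left.1.le, hmax.left.2.le⟩
  have hs : s ∈ Icc a b := ⟨hmax.right.1.le, hmax.right.2.le⟩
  have hη1 : η ≤ η₁ := min_le_left _ _
  have hη2 : η ≤ κ := (min_le_right _ _).trans (min_le_left _ _)
  have hη3 : η ≤ κ / (K₁ + 2 * K₂) := (min_le_right _ _).trans (min_le_right _ _)
  rw [htb0, sub_zero] at hanc
  have hht : h t = θ * (t - tb) + K * κ * (t - tb) ^ 2 := rfl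
  rw [hht] at hanc
  have hut := abs_le.1 (huR x t ht)
  have hutb := abs_le.1 (huR xb tb htb)
  have ha1 : -(κ * R) ≤ κ * u x t := by
    rw [← mul_neg]; exact mul_le_mul_of_nonneg_left hut.1 hκ0.le
  have ha2 : κ * u xb tb ≤ κ * R := mul_le_mul_of_nonneg_left hutb.2 hκ0.le
  have hμκ : μ = 1 - κ := by rw [hκ]; ring
  -- The penalty equals κ times the left side, while the errors from linearization and from doubling
  -- are at most 2Rκ and κ. Dividing by κ gives a bound that survives μ → 1.
  have hloc : K * (‖x - xb‖ ^ 2 + (t - tb) ^ 2) ≤ 1 + 2 * R := by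
    refine le_of_mul_le_mul_left ?_ hκ0
    rw [hμκ] at hanc
    linarith
  have hxr : 2 * K * ‖x - xb‖ ≤ L₀ := by
    linarith [mul_nonneg hK.le (sq_nonneg (‖x - xb‖ - 1)), mul_nonneg hK.le (sq_nonneg (t - tb))]
  have htr : -L₀ ≤ 2 * K * (t - tb) := by
    linarith [mul_nonneg hK.le (sq_nonneg (t - tb + 1)), mul_nonneg hK.le (sq_nonneg ‖x - xb‖)]
  have hp1 : 0 ≤ K * κ * ‖x - xb‖ ^ 2 := by positivity
  have hp2 : 0 ≤ K * κ * (t - tb) ^ 2 := by positivity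
  refine ⟨x, y, t, s, ht, hs, hxy.trans_le hη2, hts.trans_le hη2, hloc, ?_, ?_⟩
  · rw [hμκ] at hanc ⊢
    linarith
  · have hq : ‖(2 * (K * κ)) • (x - xb)‖ ≤ κ * L₀ := by
      rw [norm_smul, Real.norm_of_nonneg (by positivity)]
      calc 2 * (K * κ) * ‖x - xb‖ = κ * (2 * K * ‖x - xb‖) := by ring
        _ ≤ κ * L₀ := by gcongr
    set q : RN N := (2 * (K * κ)) • (x - xb) with hqdef
    have hζ := hmod ‖x - y‖ (norm_nonneg _) (hxy.trans_le hη1)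
    have hLβ : κ * β / 2 * L = κ * (c * L₀) := by rw [hL]; field_simp
    have hcq : c * ‖q‖ ≤ κ * (c * L₀) := by
      linarith [mul_le_mul_of_nonneg_left hq hc.le]
    have hham := hamiltonian_difference_lower (x := x) (y := y) (p := (2 * l) • (x - y))
      hm hc.le hζ₂ hH1 hH2 ⟨hμ0, hμ1⟩ hLpos (hq.trans hμL)
      (by rw [← hκ, ← hβ, hLβ]; exact hcq)
      (by rw [← hκ, ← hβ]; exact (hζ.trans_le (min_le_left _ _)).le)
    have hcomb := hmax.combined hj hus hvs hhc ha hμ0 hα.le hl.le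
      (measurable_slice_of_usc hus.usc (ha.le.trans ht.1))
      (measurable_slice_of_lsc hvs.lsc (ha.le.trans hs.1)) (fun x => huR x t ht)
      (fun x => hvR x s hs) hδ₀pos hδ₀ hK₁ hK₂
    have hderiv : deriv h t = θ + κ * (2 * K * (t - tb)) := by
      have h1 := ((hasDerivAt_id t).sub_const tb).const_mul θ
      have h2 := (((hasDerivAt_id t).sub_const tb).pow 2).const_mul (K * κ)
      refine (h1.add h2).deriv.trans ?_
      simp only [id, Nat.cast_ofNat, Nat.add_one_sub_one, pow_one, mul_one]
      ring
    rw [hderiv] at hcomb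
    have e1 : κ * -L₀ ≤ κ * (2 * K * (t - tb)) := by gcongr
    have e2 : (K₁ + 2 * K₂) * (l * ‖x - y‖ ^ 2) ≤ κ := by
      have := hlxy.le.trans hη3
      rw [le_div_iff₀ (by positivity)] at this
      linarith
    have e3 : ‖q‖ * C * n₀ ≤ κ * L₀ * C * n₀ := by gcongr
    have e4 : ζ₁ ‖x - y‖ ≤ κ := (hζ.trans_le (min_le_right _ _)).le
    have e5 : c * ‖q‖ * (1 + L ^ (m - 1)) ≤ κ * (c * L₀) * (1 + L ^ (m - 1)) := by
      have : 0 ≤ L ^ (m - 1) := Real.rpow_nonneg hLpos.le _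
      gcongr
    rw [← hκ] at hham
    linarith

/-- Passing to the limit `μ → 1`: a contact point at which the nonlocal term is controlled. -/
lemma exists_contact_point {m c A b₀ : ℝ} {ζ₁ ζ₂ : ℝ → ℝ} (hj : JumpKernel ν j C)
    (hus : IsViscositySubsolution ν j H u) (hvs : IsViscositySupersolution ν j H v)
    (hm : 1 < m) (hc : 0 < c) (hζ₁ : IsModulus ζ₁)
    (hζ₂ : ∀ s, ζ₂ s = c * |s|) (hH1 : HamiltonianH1 H m ζ₁ ζ₂) (hb₀ : 0 < b₀)
    (hH2 : ∀ μ : ℝ, μ ∈ Ioo (0 : ℝ) 1 → ∀ x p : RN N,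
      H x p - μ * H x (μ⁻¹ • p) ≤ (1 - μ) * (b₀ * (1 - m) * ‖p‖ ^ m + A))
    (ha : 0 < a) {R K θ tb : ℝ} (hR : 0 ≤ R)
    (huR : ∀ x, ∀ t ∈ Icc a b, |u x t| ≤ R) (hvR : ∀ x, ∀ t ∈ Icc a b, |v x t| ≤ R)
    (htb : tb ∈ Icc a b)
    (hM : ∀ x, ∀ t ∈ Icc a b, u x t - v x t ≤ u xb tb - v xb tb + θ * (t - tb))
    (hK : 0 < K)
    (hbdry : ∀ᶠ μ in 𝓝[<] (1 : ℝ), ∀ x, ∀ t, t = a ∨ t = b → μ * u x t - v x t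
      - K * (1 - μ) * ‖x - xb‖ ^ 2 - (θ * (t - tb) + K * (1 - μ) * (t - tb) ^ 2)
      < μ * u xb tb - v xb tb)
    {δ₀ : ℝ} (hδ₀pos : 0 < δ₀) (hδ₀ : δ₀ ≤ 1) :
    ∃ x t, t ∈ Icc a b ∧ K * (‖x - xb‖ ^ 2 + (t - tb) ^ 2) ≤ 1 + 2 * R ∧
      u x t - v x t = u xb tb - v xb tb + θ * (t - tb) ∧
      IntegrableOn (fun z => u (x + j x z) t - v (x + j x z) t - (u x t - v x t))
        (Metric.ball 0 δ₀)ᶜ ν ∧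
      θ ≤ ∫ z in (Metric.ball 0 δ₀)ᶜ, (u (x + j x z) t - v (x + j x z) t - (u x t - v x t)) ∂ν := by
  obtain ⟨Q, hQ⟩ := exists_approximate_points hj hus hvs hm hc hζ₁ hζ₂ hH1 hb₀ hH2 ha hR huR hvR
    htb hM hK hbdry hδ₀pos hδ₀
  have hex : ∀ n : ℕ, ∃ μ, (∃ x y t s, t ∈ Icc a b ∧ s ∈ Icc a b ∧ ‖x - y‖ < 1 - μ ∧
      |t - s| < 1 - μ ∧ K * (‖x - xb‖ ^ 2 + (t - tb) ^ 2) ≤ 1 + 2 * R ∧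
      u xb tb - v xb tb + θ * (t - tb) - (1 - μ) * R ≤ μ * u x t - v y s ∧
      θ ≤ (1 - μ) * Q + ∫ z in (Metric.ball 0 δ₀)ᶜ, jumpGap j u v μ x y t s z ∂ν) ∧
      μ ∈ Ioo (1 - 1 / ((n : ℝ) + 1)) 1 := fun n =>
    (hQ.and (Ioo_mem_nhdsLT (sub_lt_self _ (by positivity)))).exists
  choose μ hpts hμ using hex
  choose x y t s ht hs hxy hts hloc hlow hint using hpts
  have hμlim : Tendsto (fun n => 1 - μ n) atTop (𝓝 0) := by
    refine squeeze_zero (fun n => by linarith [(hμ n).2]) (fun n => ?_)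
      tendsto_one_div_add_atTop_nhds_zero_nat
    linarith [(hμ n).1]
  have hcomp : IsCompact (Metric.closedBall xb ((1 + 2 * R) / K + 1) ×ˢ Icc a b) :=
    (isCompact_closedBall _ _).prod isCompact_Icc
  obtain ⟨⟨x', t'⟩, ⟨-, ht'⟩, φ, hφ, hlim⟩ := hcomp.tendsto_subseq (x := fun n => (x n, t n))
    (fun n => ⟨by
      rw [mem_closedBall_iff_norm]
      have h1 : ‖x n - xb‖ ^ 2 ≤ (1 + 2 * R) / K := by
        rw [le_div_iff₀ hK]; nlinarith [hloc n, sq_nonneg (t n - tb)]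
      nlinarith [sq_nonneg (‖x n - xb‖ - 1)], ht n⟩)
  simp only at ht'
  have lx : Tendsto (fun n => x (φ n)) atTop (𝓝 x') := (continuous_fst.tendsto (x', t')).comp hlim
  have lt : Tendsto (fun n => t (φ n)) atTop (𝓝 t') := (continuous_snd.tendsto (x', t')).comp hlim
  have lμ : Tendsto (fun n => 1 - μ (φ n)) atTop (𝓝 0) := hμlim.comp hφ.tendsto_atTop
  have ly : Tendsto (fun n => y (φ n)) atTop (𝓝 x') := by
    have h0 : Tendsto (fun n => x (φ n) - y (φ n)) atTop (𝓝 0) :=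
      squeeze_zero_norm (fun n => (hxy (φ n)).le) lμ
    simpa using lx.sub h0
  have ls : Tendsto (fun n => s (φ n)) atTop (𝓝 t') := by
    have h0 : Tendsto (fun n => t (φ n) - s (φ n)) atTop (𝓝 0) :=
      squeeze_zero_norm (fun n => (hts (φ n)).le) lμ
    simpa using lt.sub h0
  have ht0 : 0 ≤ t' := ha.le.trans ht'.1
  set M' := u xb tb - v xb tb + θ * (t' - tb) with hM'
  have hlow' : ∀ e : ℝ, 0 < e → ∀ᶠ n in atTop,
      M' - e < μ (φ n) * u (x (φ n)) (t (φ n)) - v (y (φ n)) (s (φ n)) := by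
    intro e he
    have h1 : Tendsto (fun n => u xb tb - v xb tb + θ * (t (φ n) - tb) - (1 - μ (φ n)) * R) atTop
        (𝓝 (M' - 0 * R)) :=
      (((lt.sub_const tb).const_mul θ).const_add _).sub (lμ.mul_const R)
    filter_upwards [h1.eventually (lt_mem_nhds (show M' - e < M' - 0 * R by linarith))] with n hn
    exact hn.trans_le (hlow _)
  -- upper limits of the linearized difference along converging points
  have hup : ∀ (X Y : ℕ → RN N) (X' : RN N), Tendsto X atTop (𝓝 X') → Tendsto Y atTop (𝓝 X') →
      ∀ e : ℝ, 0 < e → ∀ᶠ n in atTop, μ (φ n) * u (X n) (t (φ n)) - v (Y n) (s (φ n))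
        < u X' t' - v X' t' + e := by
    intro X Y X' hX hY e he
    filter_upwards [eventually_lt_of_usc hus.usc hX lt
        (Eventually.of_forall fun n => ha.le.trans (ht _).1) ht0 (show 0 < e / 3 by positivity),
      eventually_gt_of_lsc hvs.lsc hY ls
        (Eventually.of_forall fun n => ha.le.trans (hs _).1) ht0 (show 0 < e / 3 by positivity),
      (lμ.mul_const R).eventually (gt_mem_nhds (show 0 * R < e / 3 by linarith))] with n h1 h2 h3
    have h4 := (abs_le.1 (huR (X n) _ (ht (φ n)))).1
    have h5 := (hμ (φ n)).2
    nlinarith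
  have hcontact : u x' t' - v x' t' = M' := by
    refine le_antisymm (hM x' t' ht') (le_of_forall_pos_le_add fun e he => ?_)
    obtain ⟨n, h1, h2⟩ := ((hlow' (e / 2) (by positivity)).and
      (hup _ _ _ lx ly (e / 2) (by positivity))).exists
    linarith
  have hfin := hj.isFiniteMeasure_restrict hδ₀pos (subset_refl (Metric.ball (0 : RN N) δ₀)ᶜ)
  set G : RN N → ℝ := fun z => u (x' + j x' z) t' - v (x' + j x' z) t' - (u x' t' - v x' t')
    with hG
  have hGi : IntegrableOn G (Metric.ball 0 δ₀)ᶜ ν :=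
    ((hj.integrableOn_landing hδ₀pos subset_rfl (measurable_slice_of_usc hus.usc ht0)
      (fun x => huR x t' ht') x').sub
      (hj.integrableOn_landing hδ₀pos subset_rfl (measurable_slice_of_lsc hvs.lsc ht0)
      (fun x => hvR x t' ht') x')).sub (integrable_const _)
  refine ⟨x', t', ht', ?_, hcontact, hGi, ?_⟩
  · exact le_of_tendsto' ((((lx.sub_const xb).norm.pow 2).add
      ((lt.sub_const tb).pow 2)).const_mul K) fun n => hloc _
  · set F : ℕ → RN N → ℝ := fun n =>
      jumpGap j u v (μ (φ n)) (x (φ n)) (y (φ n)) (t (φ n)) (s (φ n)) with hF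
    have hμ0 : ∀ n, 0 ≤ μ n := fun n => by
      have h1 := (hμ n).1
      have h2 : 1 / ((n : ℝ) + 1) ≤ 1 := by
        rw [div_le_one (by positivity)]; linarith [(n.cast_nonneg : (0 : ℝ) ≤ n)]
      linarith
    have hFi : ∀ n, IntegrableOn (F n) (Metric.ball 0 δ₀)ᶜ ν := fun n =>
      hj.integrableOn_jumpGap hδ₀pos subset_rfl
        (measurable_slice_of_usc hus.usc (ha.le.trans (ht _).1))
        (measurable_slice_of_lsc hvs.lsc (ha.le.trans (hs _).1)) (fun x => huR x _ (ht _))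
        (fun x => hvR x _ (hs _)) _ _ _
    have hFb : ∀ n z, |F n z| ≤ 4 * R := by
      intro n z
      have hu' : ∀ X, |μ (φ n) * u X (t (φ n))| ≤ R := fun X => by
        rw [abs_mul, abs_of_nonneg (hμ0 _)]
        have := huR X _ (ht (φ n))
        nlinarith [(hμ (φ n)).2, abs_nonneg (u X (t (φ n)))]
      have h1 := abs_le.1 (hu' (x (φ n) + j (x (φ n)) z))
      have h2 := abs_le.1 (hu' (x (φ n)))
      have h3 := abs_le.1 (hvR (y (φ n) + j (y (φ n)) z) _ (hs (φ n)))
      have h4 := abs_le.1 (hvR (y (φ n)) _ (hs (φ n)))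
      rw [abs_le]
      simp only [hF, jumpGap]
      constructor <;> linarith
    have hGb : ∀ z, |G z| ≤ 4 * R := by
      intro z
      have h1 := abs_le.1 (huR (x' + j x' z) _ ht')
      have h2 := abs_le.1 (huR x' _ ht')
      have h3 := abs_le.1 (hvR (x' + j x' z) _ ht')
      have h4 := abs_le.1 (hvR x' _ ht')
      rw [abs_le]
      simp only [hG]
      constructor <;> linarith
    -- Semicontinuity bounds `F n z` only from above in the limit, so it need not converge; its
    -- maximum with `G z` does. Domination by 4R suffices because ν is finite off the ball.
    have hlimI : Tendsto (fun n => ∫ z in (Metric.ball 0 δ₀)ᶜ, max (F n z) (G z) ∂ν) atTop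
        (𝓝 (∫ z in (Metric.ball 0 δ₀)ᶜ, G z ∂ν)) := by
      refine tendsto_integral_of_dominated_convergence (fun _ => 4 * R)
        (fun n => ((hFi n).sup hGi).aestronglyMeasurable) (integrable_const _)
        (fun n => Eventually.of_forall fun z => ?_) (Eventually.of_forall fun z => ?_)
      · exact (abs_max_le_max_abs_abs).trans (max_le (hFb n z) (hGb z))
      · have hX : Tendsto (fun n => x (φ n) + j (x (φ n)) z) atTop (𝓝 (x' + j x' z)) :=
          lx.add (((hj.cont_left z).tendsto x').comp lx)
        have hY : Tendsto (fun n => y (φ n) + j (y (φ n)) z) atTop (𝓝 (x' + j x' z)) :=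
          ly.add (((hj.cont_left z).tendsto x').comp ly)
        refine tendsto_order.2 ⟨fun r hr => Eventually.of_forall fun n =>
          hr.trans_le (le_max_right _ _), fun r hr => ?_⟩
        have he : 0 < (r - G z) / 2 := by linarith
        -- The base value enters with a minus sign and needs the lower bound `hlow'`; the landing
        -- value needs only the upper one.
        filter_upwards [hup _ _ _ hX hY _ he, hlow' _ he] with n h1 h2
        refine max_lt ?_ hr
        simp only [hG] at h1 h2 hr ⊢
        simp only [hF, jumpGap]
        linarith
    have hθ : ∀ n, θ ≤ (1 - μ (φ n)) * Q + ∫ z in (Metric.ball 0 δ₀)ᶜ, max (F n z) (G z) ∂ν := by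
      intro n
      refine (hint (φ n)).trans (add_le_add_right ?_ _)
      exact integral_mono (hFi n) ((hFi n).sup hGi) fun z => le_max_left _ _
    have := ge_of_tendsto' ((lμ.mul_const Q).add hlimI) hθ
    simpa using this

end LimitPoint

/-! ### Propagation of the maximum in time and along jumps -/

section Propagation

variable {N : ℕ} {ν : Measure (RN N)} {j : RN N → RN N → RN N} {C : ℝ}
  {H : RN N → RN N → ℝ} {u v : RN N → ℝ → ℝ}

lemma exists_lattice_translate (x : RN N) :
    ∃ k : Fin N → ℤ, ‖x + latticeVec k‖ ≤ √N := by
  refine ⟨fun i => -⌊x i⌋, Real.le_sqrt_of_sq_le ?_⟩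
  rw [EuclideanSpace.norm_sq_eq]
  calc ∑ i, ‖(x + latticeVec fun i => -⌊x i⌋) i‖ ^ 2 ≤ ∑ _i : Fin N, (1 : ℝ) := by
        refine Finset.sum_le_sum fun i _ => ?_
        have : (x + latticeVec fun i => -⌊x i⌋) i = Int.fract (x i) := by
          simp [latticeVec, Int.fract, sub_eq_add_neg]
        rw [this, Real.norm_of_nonneg (Int.fract_nonneg _)]
        exact pow_le_one₀ (Int.fract_nonneg _) (Int.fract_lt_one _).le
    _ = N := by simp

/-- A closed periodic set containing points whose projections are dense is everything. -/
lemma mem_of_dense_toTorus {F S : Set (RN N)} (hF : IsClosed F)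
    (hper : ∀ (k : Fin N → ℤ) x, x ∈ F → x + latticeVec k ∈ F) (hS : S ⊆ F)
    (hd : closure (toTorus '' S) = univ) (y : RN N) : y ∈ F := by
  -- As the projection is open, every ball about y contains a lattice translate of a point of S,
  -- hence a point of F.
  have hopen : IsOpenMap (toTorus : RN N → UnitAddTorus (Fin N)) := by
    have h1 : IsOpenMap (Pi.map fun (_ : Fin N) (r : ℝ) => (r : UnitAddCircle)) :=
      IsOpenMap.piMap (fun _ => QuotientAddGroup.isOpenMap_coe)
        (Filter.Eventually.of_forall fun _ => QuotientAddGroup.mk_surjective)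
    exact h1.comp (EuclideanSpace.equiv (Fin N) ℝ).toHomeomorph.isOpenMap
  rw [← hF.closure_eq, Metric.mem_closure_iff]
  intro e he
  have hy : toTorus y ∈ closure (toTorus '' S) := hd ▸ mem_univ _
  obtain ⟨w, ⟨y', hy', rfl⟩, ξ, hξ, hw⟩ := mem_closure_iff.1 hy _
    (hopen _ (Metric.isOpen_ball (x := y) (ε := e))) (mem_image_of_mem _ (Metric.mem_ball_self he))
  have hk : ∀ i, ∃ k : ℤ, y' i = ξ i + k := by
    intro i
    have h1 : ((ξ i : ℝ) : UnitAddCircle) = (y' i : ℝ) := congrFun hw i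
    have h2 : ((y' i - ξ i : ℝ) : UnitAddCircle) = 0 := by
      rw [AddCircle.coe_sub, h1, sub_self]
    obtain ⟨k, hk⟩ := (AddCircle.coe_eq_zero_iff (1 : ℝ)).1 h2
    refine ⟨k, ?_⟩
    rw [zsmul_one] at hk
    linarith
  choose k hk using hk
  refine ⟨y', ?_, by simpa [dist_comm] using hy'⟩
  have : y' = ξ + latticeVec k := by
    ext i; simp [latticeVec, hk]
  exact this ▸ hper k ξ (hS hξ)

lemma upperSemicontinuousOn_sub_sub_linear
    (hu : UpperSemicontinuousOn (fun q : RN N × ℝ => u q.1 q.2) (univ ×ˢ Ici 0))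
    (hv : LowerSemicontinuousOn (fun q : RN N × ℝ => v q.1 q.2) (univ ×ˢ Ici 0)) (θ : ℝ) :
    UpperSemicontinuousOn (fun q : RN N × ℝ => u q.1 q.2 + - v q.1 q.2 + -(θ * q.2))
      (univ ×ˢ Ici 0) := by
  refine (hu.add (continuous_neg.comp_lowerSemicontinuousOn_antitone hv
    fun _ _ h => neg_le_neg h)).add ?_
  exact Continuous.upperSemicontinuous (by fun_prop) |>.upperSemicontinuousOn _

/-- A periodic upper semicontinuous function attains its maximum on a time strip. -/
lemma exists_max_on_strip
    (hu : UpperSemicontinuousOn (fun q : RN N × ℝ => u q.1 q.2) (univ ×ˢ Ici 0))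
    (hv : LowerSemicontinuousOn (fun q : RN N × ℝ => v q.1 q.2) (univ ×ˢ Ici 0))
    (hup : ∀ t, 0 ≤ t → IntPeriodic (fun x => u x t))
    (hvp : ∀ t, 0 ≤ t → IntPeriodic (fun x => v x t)) (θ : ℝ) {a b : ℝ} (ha : 0 ≤ a)
    (hab : a ≤ b) :
    ∃ xb, ∃ tb ∈ Icc a b, ∀ x, ∀ t ∈ Icc a b,
      u x t - v x t ≤ u xb tb - v xb tb + θ * (t - tb) := by
  have hcomp : IsCompact (Metric.closedBall (0 : RN N) √N ×ˢ Icc a b) :=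
    (isCompact_closedBall _ _).prod isCompact_Icc
  have hne : (Metric.closedBall (0 : RN N) √N ×ˢ Icc a b).Nonempty :=
    ⟨(0, a), by simp, ⟨le_rfl, hab⟩⟩
  obtain ⟨⟨xb, tb⟩, ⟨-, htb⟩, hmax⟩ :=
    ((upperSemicontinuousOn_sub_sub_linear hu hv θ).mono
      (prod_mono (subset_univ _) fun t ht => ha.trans ht.1)).exists_isMaxOn hne hcomp
  refine ⟨xb, tb, htb, fun x t ht => ?_⟩
  obtain ⟨k, hk⟩ := exists_lattice_translate x
  have h1 := hmax (show (x + latticeVec k, t) ∈ _ from ⟨by simpa using hk, ht⟩)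
  simp only [mem_ofPred_eq] at h1
  have h2 := hup t (ha.trans ht.1) k x
  have h3 := hvp t (ha.trans ht.1) k x
  simp only at h2 h3
  rw [h2, h3] at h1
  linarith

/-- Backward propagation in time: the maximum is attained at every earlier positive time. -/
lemma exists_max_at_earlier_time {m c A b₀ : ℝ} {ζ₁ ζ₂ : ℝ → ℝ} (hj : JumpKernel ν j C)
    (hus : IsViscositySubsolution ν j H u) (hvs : IsViscositySupersolution ν j H v)
    (hm : 1 < m) (hc : 0 < c) (hζ₁ : IsModulus ζ₁)
    (hζ₂ : ∀ s, ζ₂ s = c * |s|) (hH1 : HamiltonianH1 H m ζ₁ ζ₂) (hb₀ : 0 < b₀)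
    (hH2 : ∀ μ : ℝ, μ ∈ Ioo (0 : ℝ) 1 → ∀ x p : RN N,
      H x p - μ * H x (μ⁻¹ • p) ≤ (1 - μ) * (b₀ * (1 - m) * ‖p‖ ^ m + A))
    (hup : ∀ t, 0 ≤ t → IntPeriodic (fun x => u x t))
    (hvp : ∀ t, 0 ≤ t → IntPeriodic (fun x => v x t))
    (hub : BoundedOnStrips u) (hvb : BoundedOnStrips v) {x₀ : RN N} {t₀ : ℝ}
    (hmax : ∀ x t, 0 < t → u x t - v x t ≤ u x₀ t₀ - v x₀ t₀) {a : ℝ} (ha : 0 < a)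
    (hat : a < t₀) : ∃ x, u x a - v x a = u x₀ t₀ - v x₀ t₀ := by
  by_contra! hne
  set M := u x₀ t₀ - v x₀ t₀ with hM
  obtain ⟨x₁, t₁, ht₁, hx₁⟩ := exists_max_on_strip hus.usc hvs.lsc hup hvp 0 ha.le (le_refl a)
  obtain rfl : t₁ = a := le_antisymm ht₁.2 ht₁.1
  have hlt : u x₁ t₁ - v x₁ t₁ < M := lt_of_le_of_ne (hmax _ _ ha) (hne _)
  set γ := M - (u x₁ t₁ - v x₁ t₁) with hγ
  have hγ0 : 0 < γ := sub_pos.2 hlt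
  set b := t₀ + 1 with hb
  have hab : t₁ ≤ b := by linarith
  -- Half of the slope γ/(t₀ - t₁): at the initial time t₁ the tilted difference stays γ/2 below its
  -- value at (x₀, t₀). At b = t₀ + 1, where u - v ≤ M still holds, the tilt alone costs θ. Neither
  -- end can carry the maximum.
  set θ := γ / (2 * (t₀ - t₁)) with hθ
  have hdt : 0 < t₀ - t₁ := sub_pos.2 hat
  have hθ0 : 0 < θ := by positivity
  have hθγ : θ * (t₀ - t₁) = γ / 2 := by rw [hθ]; field_simp
  obtain ⟨R₁, hR₁⟩ := hub b (by linarith)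
  obtain ⟨R₂, hR₂⟩ := hvb b (by linarith)
  set R := max 0 (max R₁ R₂) with hR
  have hsub : ∀ t ∈ Icc t₁ b, t ∈ Icc 0 b := fun t ht => ⟨ha.le.trans ht.1, ht.2⟩
  have huR : ∀ x, ∀ t ∈ Icc t₁ b, |u x t| ≤ R := fun x t ht =>
    (hR₁ x t (hsub t ht)).trans ((le_max_left _ _).trans (le_max_right _ _))
  have hvR : ∀ x, ∀ t ∈ Icc t₁ b, |v x t| ≤ R := fun x t ht =>
    (hR₂ x t (hsub t ht)).trans ((le_max_right _ _).trans (le_max_right _ _))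
  have hR0 : 0 ≤ R := le_max_left _ _
  obtain ⟨xb, tb, htb, hmx⟩ := exists_max_on_strip hus.usc hvs.lsc hup hvp θ ha.le hab
  have hanchor : M ≤ u xb tb - v xb tb + θ * (t₀ - tb) := hmx x₀ t₀ ⟨hat.le, by linarith⟩
  have hbdry : ∀ᶠ μ in 𝓝[<] (1 : ℝ), ∀ x, ∀ t, t = t₁ ∨ t = b → μ * u x t - v x t
      - 1 * (1 - μ) * ‖x - xb‖ ^ 2 - (θ * (t - tb) + 1 * (1 - μ) * (t - tb) ^ 2)
      < μ * u xb tb - v xb tb := by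
    set e := min (γ / 2) θ / (2 * R + 1) with he
    have he0 : 0 < e := by positivity
    filter_upwards [Ioo_mem_nhdsLT (sub_lt_self (1 : ℝ) he0)] with μ hμ x t ht
    have hκ : 0 < 1 - μ := by linarith [hμ.2]
    have hκe : (1 - μ) * (2 * R + 1) < min (γ / 2) θ := by
      rw [← lt_div_iff₀ (by positivity)]; linarith [hμ.1]
    have hκ1 := hκe.trans_le (min_le_left _ _)
    have hκ2 := hκe.trans_le (min_le_right _ _)
    have hti : t ∈ Icc t₁ b := by
      rcases ht with rfl | rfl
      · exact ⟨le_rfl, hab⟩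
      · exact ⟨hab, le_rfl⟩
    have h1 := mul_le_mul_of_nonneg_left (abs_le.1 (huR x t hti)).1 hκ.le
    have h2 := mul_le_mul_of_nonneg_left (abs_le.1 (huR xb tb htb)).2 hκ.le
    have h3 : 0 ≤ (1 - μ) * ‖x - xb‖ ^ 2 := by positivity
    have h4 : 0 ≤ (1 - μ) * (t - tb) ^ 2 := by positivity
    have hgap : u x t - v x t - θ * (t - tb) + (1 - μ) * (2 * R) < u xb tb - v xb tb := by
      rcases ht with rfl | rfl
      · have := hx₁ x t ⟨le_rfl, le_rfl⟩
        linarith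
      · have := hmax x b (by linarith)
        rw [hb] at this ⊢
        linarith
    linarith
  obtain ⟨x, t, ht, -, hxt, -, hint⟩ := exists_contact_point hj hus hvs hm hc hζ₁ hζ₂ hH1 hb₀ hH2
    ha hR0 huR hvR htb hmx one_pos hbdry one_pos le_rfl
  -- At the fixed time t the tilt is constant in space, so maximality at (x, t) makes the integrand
  -- nonpositive.
  refine absurd (hint.trans (integral_nonpos fun z => ?_)) (not_le.2 hθ0)
  have := hmx (x + j x z) t ht
  simp only [Pi.zero_apply]
  linarith

/-- Horizontal propagation: the contact set is stable under the jumps. -/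
lemma max_at_jump {m c A b₀ : ℝ} {ζ₁ ζ₂ : ℝ → ℝ} (hj : JumpKernel ν j C)
    (hus : IsViscositySubsolution ν j H u) (hvs : IsViscositySupersolution ν j H v)
    (hm : 1 < m) (hc : 0 < c) (hζ₁ : IsModulus ζ₁)
    (hζ₂ : ∀ s, ζ₂ s = c * |s|) (hH1 : HamiltonianH1 H m ζ₁ ζ₂) (hb₀ : 0 < b₀)
    (hH2 : ∀ μ : ℝ, μ ∈ Ioo (0 : ℝ) 1 → ∀ x p : RN N,
      H x p - μ * H x (μ⁻¹ • p) ≤ (1 - μ) * (b₀ * (1 - m) * ‖p‖ ^ m + A))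
    (hub : BoundedOnStrips u) (hvb : BoundedOnStrips v) {M : ℝ}
    (hmax : ∀ x t, 0 < t → u x t - v x t ≤ M) {xb : RN N} {tb : ℝ} (htb : 0 < tb)
    (hM : u xb tb - v xb tb = M) {z : RN N} (hz : z ∈ ν.support) :
    u (xb + j xb z) tb - v (xb + j xb z) tb = M := by
  rcases eq_or_ne z 0 with rfl | hz0
  · rw [hj.apply_zero, add_zero, hM]
  have hzn : 0 < ‖z‖ := norm_pos_iff.2 hz0
  -- The given z has to lie outside the ball, since the contact inequality retains only those jumps.
  set δ₀ := min 1 (‖z‖ / 2) with hδ₀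
  have hδpos : 0 < δ₀ := by positivity
  have hδz : δ₀ < ‖z‖ := (min_le_right _ _).trans_lt (by linarith)
  set a := tb / 2 with ha
  set b := tb + 1 with hb
  have ha0 : 0 < a := by positivity
  obtain ⟨R₁, hR₁⟩ := hub b (by linarith)
  obtain ⟨R₂, hR₂⟩ := hvb b (by linarith)
  set R := max 0 (max R₁ R₂) with hR
  have hsub : ∀ t ∈ Icc a b, t ∈ Icc 0 b := fun t ht => ⟨ha0.le.trans ht.1, ht.2⟩
  have huR : ∀ x, ∀ t ∈ Icc a b, |u x t| ≤ R := fun x t ht =>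
    (hR₁ x t (hsub t ht)).trans ((le_max_left _ _).trans (le_max_right _ _))
  have hvR : ∀ x, ∀ t ∈ Icc a b, |v x t| ≤ R := fun x t ht =>
    (hR₂ x t (hsub t ht)).trans ((le_max_right _ _).trans (le_max_right _ _))
  have hR0 : 0 ≤ R := le_max_left _ _
  have htb' : tb ∈ Icc a b := ⟨by linarith, by linarith⟩
  -- With no tilt, only the time penalty excludes the ends, which lie at distances a and 1 from tb.
  -- This constant makes it exceed the linearization error 2R(1 - μ) for every n.
  set K₀ := (2 * R + 1) / min (a ^ 2) 1 with hK₀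
  have hmin : 0 < min (a ^ 2) 1 := by positivity
  -- approximate contact points
  have hpt : ∀ n : ℕ, ∃ x t, t ∈ Icc a b ∧
      ‖x - xb‖ ^ 2 + (t - tb) ^ 2 ≤ (1 + 2 * R) / ((n : ℝ) + 1) ∧
      u (x + j x z) t - v (x + j x z) t = M := by
    intro n
    have hKpos : 0 < K₀ + (n + 1) := by positivity
    have hbdry : ∀ᶠ μ in 𝓝[<] (1 : ℝ), ∀ x, ∀ t, t = a ∨ t = b → μ * u x t - v x t
        - (K₀ + (n + 1)) * (1 - μ) * ‖x - xb‖ ^ 2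
        - (0 * (t - tb) + (K₀ + (n + 1)) * (1 - μ) * (t - tb) ^ 2)
        < μ * u xb tb - v xb tb := by
      filter_upwards [self_mem_nhdsWithin] with μ hμ x t ht
      have hκ : 0 < 1 - μ := sub_pos.2 hμ
      have hti : t ∈ Icc a b := by
        rcases ht with rfl | rfl
        · exact ⟨le_rfl, by linarith⟩
        · exact ⟨by linarith, le_rfl⟩
      have hsq : min (a ^ 2) 1 ≤ (t - tb) ^ 2 := by
        rcases ht with rfl | rfl
        · refine (min_le_left _ _).trans (le_of_eq ?_)
          rw [ha]; ring
        · refine (min_le_right _ _).trans (le_of_eq ?_)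
          rw [hb]; ring
      have hKsq : 2 * R + 1 ≤ (K₀ + (n + 1)) * (t - tb) ^ 2 := by
        calc 2 * R + 1 = K₀ * min (a ^ 2) 1 := by rw [hK₀]; field_simp
          _ ≤ (K₀ + (n + 1)) * (t - tb) ^ 2 := by
            gcongr
            linarith [(n.cast_nonneg : (0 : ℝ) ≤ n)]
      have h1 := mul_le_mul_of_nonneg_left (abs_le.1 (huR x t hti)).1 hκ.le
      have h2 := mul_le_mul_of_nonneg_left (abs_le.1 (huR xb tb htb')).2 hκ.le
      have h3 : 0 ≤ (K₀ + (n + 1)) * (1 - μ) * ‖x - xb‖ ^ 2 := by positivity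
      have h4 := mul_le_mul_of_nonneg_left hKsq hκ.le
      have h5 := hmax x t (ha0.trans_le hti.1)
      linarith
    obtain ⟨x, t, ht, hloc, hxt, hi, hint⟩ := exists_contact_point (θ := 0) (xb := xb) hj hus hvs
      hm hc hζ₁ hζ₂ hH1 hb₀ hH2 ha0 hR0 huR hvR htb'
      (fun x t ht => by rw [hM]; simpa using hmax x t (ha0.trans_le ht.1)) hKpos hbdry hδpos
      (min_le_left _ _)
    rw [zero_mul, add_zero, hM] at hxt
    refine ⟨x, t, ht, ?_, ?_⟩
    · rw [le_div_iff₀ (by positivity)]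
      have : 0 ≤ K₀ * (‖x - xb‖ ^ 2 + (t - tb) ^ 2) := by positivity
      linarith
    · have ht0 : 0 < t := ha0.trans_le ht.1
      -- A nonpositive integrand with nonnegative integral vanishes almost everywhere off the ball.
      -- A strict deficit at z would persist at nearby points of the support, and these have
      -- positive measure.
      by_contra hneq
      have hlt : u (x + j x z) t - v (x + j x z) t < M := lt_of_le_of_ne (hmax _ _ ht0) hneq
      have hneg : ∀ z, u (x + j x z) t - v (x + j x z) t - (u x t - v x t) ≤ 0 := fun z => by
        have := hmax (x + j x z) t ht0
        linarith
      have hae : ∀ᵐ z' ∂ν.restrict (Metric.ball 0 δ₀)ᶜ,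
          u (x + j x z') t - v (x + j x z') t = M := by
        have h0 : ∫ z in (Metric.ball 0 δ₀)ᶜ,
            -(u (x + j x z) t - v (x + j x z) t - (u x t - v x t)) ∂ν = 0 := by
          rw [integral_neg, neg_eq_zero]
          exact le_antisymm (integral_nonpos hneg) hint
        rw [integral_eq_zero_iff_of_nonneg (fun z => neg_nonneg.2 (hneg z)) hi.neg] at h0
        filter_upwards [h0] with z' hz'
        simp only [Pi.zero_apply] at hz'
        linarith
      rw [ae_restrict_iff' measurableSet_ball.compl] at hae
      have hcont : Tendsto (fun z' => x + j x z') (𝓝[ν.support] z) (𝓝 (x + j x z)) :=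
        (hj.cont_right x z hz).const_add x
      have he : 0 < (M - (u (x + j x z) t - v (x + j x z) t)) / 2 := by linarith
      have hev : ∀ᶠ z' in 𝓝[ν.support] z, u (x + j x z') t - v (x + j x z') t < M := by
        filter_upwards [eventually_lt_of_usc hus.usc hcont tendsto_const_nhds
            (Eventually.of_forall fun _ => ht0.le) ht0.le he,
          eventually_gt_of_lsc hvs.lsc hcont tendsto_const_nhds
            (Eventually.of_forall fun _ => ht0.le) ht0.le he] with z' h1 h2
        linarith
      rw [eventually_nhdsWithin_iff] at hev
      have hfar : ∀ᶠ z' in 𝓝 z, z' ∈ (Metric.ball (0 : RN N) δ₀)ᶜ := by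
        filter_upwards [continuous_norm.tendsto z |>.eventually (lt_mem_nhds hδz)] with z' hz'
        simpa using hz'.le
      have hpos := (Measure.mem_support_iff_forall z).1 hz _ (hev.and hfar)
      refine hpos.ne' ?_
      refine measure_mono_null (fun z' hz' => ?_)
        (ae_iff.1 (hae.and (Measure.support_mem_ae (μ := ν))))
      rintro ⟨h1, h2⟩
      exact (hz'.1 h2).ne (h1 hz'.2)
  choose x t ht hloc hval using hpt
  have l0 : Tendsto (fun n : ℕ => (1 + 2 * R) / ((n : ℝ) + 1)) atTop (𝓝 0) :=
    ((tendsto_const_div_atTop_nhds_zero_nat (1 + 2 * R)).comp (tendsto_add_atTop_nat 1)).congr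
      fun k => by simp
  have lx : Tendsto x atTop (𝓝 xb) := by
    have h1 : Tendsto (fun n => ‖x n - xb‖ ^ 2) atTop (𝓝 0) := squeeze_zero (fun n => sq_nonneg _)
      (fun n => (le_add_of_nonneg_right (sq_nonneg _)).trans (hloc n)) l0
    have h2 := h1.sqrt
    simp only [Real.sqrt_sq (norm_nonneg _), Real.sqrt_zero] at h2
    exact tendsto_iff_norm_sub_tendsto_zero.2 h2
  have lt : Tendsto t atTop (𝓝 tb) := by
    have h1 : Tendsto (fun n => (t n - tb) ^ 2) atTop (𝓝 0) := squeeze_zero (fun n => sq_nonneg _)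
      (fun n => (le_add_of_nonneg_left (sq_nonneg _)).trans (hloc n)) l0
    have h2 := h1.sqrt
    simp only [Real.sqrt_sq_eq_abs, Real.sqrt_zero] at h2
    exact tendsto_iff_norm_sub_tendsto_zero.2 h2
  -- The contact points only approximate (xb, tb). Continuity of j(·, z) and upper semicontinuity of
  -- u - v bring the conclusion back to xb itself.
  have lX : Tendsto (fun n => x n + j (x n) z) atTop (𝓝 (xb + j xb z)) :=
    lx.add (((hj.cont_left z).tendsto xb).comp lx)
  refine le_antisymm (hmax _ _ htb) (le_of_forall_pos_le_add fun e he => ?_)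
  have ht0 : ∀ᶠ n in atTop, 0 ≤ t n := Eventually.of_forall fun n => ha0.le.trans (ht n).1
  obtain ⟨n, h1, h2⟩ := ((eventually_lt_of_usc hus.usc lX lt ht0 htb.le (half_pos he)).and
    (eventually_gt_of_lsc hvs.lsc lX lt ht0 htb.le (half_pos he))).exists
  linarith [hval n]

/-- The closedness of the contact set at a fixed time. -/
lemma isClosed_contact
    (hu : UpperSemicontinuousOn (fun q : RN N × ℝ => u q.1 q.2) (univ ×ˢ Ici 0))
    (hv : LowerSemicontinuousOn (fun q : RN N × ℝ => v q.1 q.2) (univ ×ˢ Ici 0)) {t M : ℝ}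
    (ht : 0 ≤ t) (hmax : ∀ x, u x t - v x t ≤ M) : IsClosed {x | u x t - v x t = M} := by
  refine isClosed_of_closure_subset fun x hx => ?_
  rw [mem_closure_iff_seq_limit] at hx
  obtain ⟨X, hX, hlim⟩ := hx
  refine le_antisymm (hmax x) (le_of_forall_pos_le_add fun e he => ?_)
  have ht0 : ∀ᶠ _n : ℕ in atTop, 0 ≤ t := Eventually.of_forall fun _ => ht
  obtain ⟨n, h1, h2⟩ := ((eventually_lt_of_usc hu hlim tendsto_const_nhds ht0 ht (half_pos he)).and
    (eventually_gt_of_lsc hv hlim tendsto_const_nhds ht0 ht (half_pos he))).exists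
  have h3 : u (X n) t - v (X n) t = M := hX n
  linarith

end Propagation

end LevyIto
end

/-! ### The strong maximum principle -/

theorem mainTheorem8 (N : ℕ)
    (ν : Measure (LevyIto.RN N)) (j : LevyIto.RN N → LevyIto.RN N → LevyIto.RN N)
    (H : LevyIto.RN N → LevyIto.RN N → ℝ)
    (hM : LevyIto.LevyCondition ν)
    (hJ1 : LevyIto.JumpBound j)
    (hJper : ∀ z, LevyIto.IntPeriodic (fun x => j x z))
    (hJcont : ∀ z, Continuous (fun x => j x z))
    (hJsupp : ∀ x, ContinuousOn (j x) ν.support)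
    (hJ2 : LevyIto.JumpLipschitz ν j)
    (hcover : LevyIto.IterativeCovering ν j)
    (hHper : ∀ p, LevyIto.IntPeriodic (fun x => H x p))
    (hH0 : LevyIto.HamiltonianH0 H)
    (m : ℝ) (hm : 1 < m) (ζ₁ ζ₂ : ℝ → ℝ) (hζ₁ : LevyIto.IsModulus ζ₁)
    (c : ℝ) (hc : 0 < c) (hζ₂ : ∀ s, ζ₂ s = c * |s|)
    (hH1 : LevyIto.HamiltonianH1 H m ζ₁ ζ₂)
    (hH2 : LevyIto.HamiltonianH2 H m)
    (u v : LevyIto.RN N → ℝ → ℝ)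
    (hu : LevyIto.IsViscositySubsolution ν j H u)
    (hv : LevyIto.IsViscositySupersolution ν j H v)
    (huper : ∀ t, 0 ≤ t → LevyIto.IntPeriodic (fun x => u x t))
    (hvper : ∀ t, 0 ≤ t → LevyIto.IntPeriodic (fun x => v x t))
    (hubdd : LevyIto.BoundedOnStrips u) (hvbdd : LevyIto.BoundedOnStrips v)
    (x₀ : LevyIto.RN N) (t₀ : ℝ) (ht₀ : 0 < t₀)
    (hmax : ∀ x t, 0 < t → u x t - v x t ≤ u x₀ t₀ - v x₀ t₀) :
    (∀ x, ∀ t ∈ Ioc 0 t₀, u x t - v x t = u x₀ t₀ - v x₀ t₀) ∧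
    ((∀ x, u x 0 - v x 0 ≤ u x₀ t₀ - v x₀ t₀) →
      ∀ x, ∀ t ∈ Icc 0 t₀, u x t - v x t = ⨆ y, (u y 0 - v y 0)) := by
  obtain ⟨C, hC, hjC⟩ := hJ1
  obtain ⟨A, b₀, -, hb₀, hH2⟩ := hH2
  have hj : LevyIto.JumpKernel ν j C := ⟨hM, hC, hjC, hJcont, hJsupp, hJ2⟩
  have main : ∀ x, ∀ t ∈ Ioc 0 t₀, u x t - v x t = u x₀ t₀ - v x₀ t₀ := by
    intro y t ht
    obtain ⟨xt, hxt⟩ : ∃ x, u x t - v x t = u x₀ t₀ - v x₀ t₀ := by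
      rcases ht.2.eq_or_lt with rfl | hlt
      · exact ⟨x₀, rfl⟩
      · exact LevyIto.exists_max_at_earlier_time hj hu hv hm hc hζ₁ hζ₂ hH1 hb₀ hH2 huper hvper
          hubdd hvbdd hmax ht.1 hlt
    have hreach : ∀ n, ∀ ξ ∈ LevyIto.reach ν j xt n, u ξ t - v ξ t = u x₀ t₀ - v x₀ t₀ := by
      intro n
      induction n with
      | zero => rintro ξ rfl; exact hxt
      | succ n ih =>
        intro ξ' hξ'
        simp only [LevyIto.reach, mem_iUnion] at hξ'
        obtain ⟨ξ, hξ, z, hz, rfl⟩ := hξ'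
        exact LevyIto.max_at_jump hj hu hv hm hc hζ₁ hζ₂ hH1 hb₀ hH2 hubdd hvbdd hmax ht.1
          (ih ξ hξ) hz
    refine LevyIto.mem_of_dense_toTorus (F := {x | u x t - v x t = u x₀ t₀ - v x₀ t₀})
      (LevyIto.isClosed_contact hu.usc hv.lsc ht.1.le fun x => hmax x t ht.1)
      (fun k x hx => ?_) (iUnion_subset hreach) (hcover xt) y
    have h1 := huper t ht.1.le k x
    have h2 := hvper t ht.1.le k x
    simp only at h1 h2
    simp only [mem_ofPred_eq] at hx ⊢
    rw [h1, h2, hx]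
  refine ⟨main, fun h0 => ?_⟩
  -- The upper bound is the extra hypothesis; the lower one comes from letting s decrease to 0 in
  -- the constancy on (0, t₀].
  have hzero : ∀ x, u x 0 - v x 0 = u x₀ t₀ - v x₀ t₀ := by
    intro x
    refine le_antisymm (h0 x) (le_of_forall_pos_le_add fun e he => ?_)
    have ht : Tendsto (fun s : ℝ => s) (𝓝[>] 0) (𝓝 0) := tendsto_id.mono_left nhdsWithin_le_nhds
    have ht0 : ∀ᶠ s : ℝ in 𝓝[>] 0, 0 ≤ s := by
      filter_upwards [self_mem_nhdsWithin] with s hs using le_of_lt hs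
    obtain ⟨s, h1, h2, h3⟩ :=
      ((LevyIto.eventually_lt_of_usc hu.usc (tendsto_const_nhds (x := x)) ht ht0 le_rfl
        (half_pos he)).and ((LevyIto.eventually_gt_of_lsc hv.lsc (tendsto_const_nhds (x := x)) ht
        ht0 le_rfl (half_pos he)).and (Ioc_mem_nhdsGT ht₀))).exists
    linarith [main x s h3]
  intro x t ht
  simp only [hzero, ciSup_const]
  rcases ht.1.eq_or_lt with rfl | hlt
  · exact hzero x
  · exact main x t ⟨hlt, ht.2⟩
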